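/- **Setting.** Let $I$ be a finite set of $d$ nodes; for $i\in I$ let $\Omega_i$ be a standard Borel space with a $\sigma$-finite reference measure $\lambda_i$ (e.g. counting measure on a countable set, Lebesgue measure on $\mathbb R$). A *causal model* $\mathfrak C$ over $\mathbf X=(X_i)_{i\in I}$ consists of a directed acyclic graph $\mathcal G$ on $I$, measurable assignments $X_i:=f_i(\mathbf X_{\mathrm{PA}_i},N_i)$, where $\mathrm{PA}_i$ is the set of parents of $i$ in $\mathcal G$, and jointly independent noise variables $N_i$ with values in standard Borel spaces. Its observational distribution $P^{\mathfrak C}_{\mathbf X}$ is the law of the unique solution $\mathbf X$ of the assignments, and it is assumed to have a density: $P^{\mathfrak C}_{\mathbf X}\ll\bigotimes_i\lambda_i$ (automatic in the discrete case). The intervention $do(X_i=x)$ replaces the assignment of $X_i$ by the constant $x$; $P^{\mathfrak C;do(X_i=x)}_{\mathbf X}$ is the resulting law of $\mathbf X$. The counterfactual model $\mathfrak C|_{X_j=x}$ keeps the graph and the assignments and replaces the joint law of the noise by its (regular) conditional law given $X_j=x$; interventions and their laws are defined for it in the same way. Let $D$ be a measurable $[0,\infty]$-valued function of pairs of probability measures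 on $\prod_i\Omega_i$ with $D(P,Q)=0\iff P=Q$. For each $i$ let $\mu_i,\nu_i$ be probability measures on $\Omega_i$ (the distributions of intervened and of observed values) such that $\lambda_i\ll\mu_i$ and $\nu_i$ has the same null sets as $\lambda_i$. Define $$OD(\mathfrak C,\mathfrak D)=D\big(P^{\mathfrak C}_{\mathbf X},P^{\mathfrak D}_{\mathbf X}\big),\qquad ID(\mathfrak C,\mathfrak D)=\frac1d\sum_{i\in I}\int D\big(P^{\mathfrak C;do(X_i=x)}_{\mathbf X},P^{\mathfrak D;do(X_i=x)}_{\mathbf X}\big)\,\mu_i(dx),$$ $$CD(\mathfrak C,\mathfrak D)=\frac1d\sum_{j\in I}\int ID\big(\mathfrak C|_{X_j=x},\mathfrak D|_{X_j=x}\big)\,\nu_j(dx).$$ **Theorem.** Let $\mathfrak C$ and $\mathfrak D$ be two causal models over the same variables (with possibly different graphs, assignments and noise). 1. If $d\ge 2$ and $ID(\mathfrak C,\mathfrak D)=0$, then $OD(\mathfrak C,\mathfrak D)=0$. 2. Suppose that in both models any two distinct variables have a positive joint density, i.e. $\lambda_i\otimes\lambda_j\ll P_{(X_i,X_j)}$ for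 all $i\ne j$ (in particular if the observational distribution is strictly positive). If $CD(\mathfrak C,\mathfrak D)=0$, then $ID(\mathfrak C,\mathfrak D)=0$. -/

import Mathlib

open MeasureTheory ProbabilityTheory
open scoped ENNReal

/-- A structural causal model over finitely many nodes `ι`: node `i` takes values in `Ω i`, is driven
by a noise variable with values in `𝒩 i`, and is assigned
`X i := f i (X restricted to the parents of i) (N i)`.
The causal graph `edge` (`edge j i` means `j → i`) is a directed acyclic graph.
The joint noise law is an arbitrary probability measure at this level, because counterfactual
models have dependent noises; independence of the noises is the predicate `SCM.IndepNoise`. -/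
structure SCM {ι : Type*} (Ω : ι → Type*) (𝒩 : ι → Type*)
    [∀ i, MeasurableSpace (Ω i)] [∀ i, MeasurableSpace (𝒩 i)] where
  edge : ι → ι → Prop
  acyclic : ∀ i, ¬ Relation.TransGen edge i i
  f : ∀ i, ((j : {j // edge j i}) → Ω j.1) → 𝒩 i → Ω i
  measurable_f : ∀ i, Measurable (Function.uncurry (f i))
  noise : Measure (∀ i, 𝒩 i)
  isProb : IsProbabilityMeasure noise

namespace SCM

section Basic

variable {ι : Type*} {Ω 𝒩 : ι → Type*}
  [∀ i, MeasurableSpace (Ω i)] [∀ i, MeasurableSpace (𝒩 i)]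

instance (M : SCM Ω 𝒩) : IsProbabilityMeasure M.noise := M.isProb

theorem wf [Finite ι] (M : SCM Ω 𝒩) : WellFounded M.edge := by
  have : Std.Irrefl (Relation.TransGen M.edge) := ⟨M.acyclic⟩
  have : IsTrans ι (Relation.TransGen M.edge) := ⟨fun _ _ _ => Relation.TransGen.trans⟩
  exact Subrelation.wf (fun h => Relation.TransGen.single h)
    (Finite.wellFounded_of_trans_of_irrefl (Relation.TransGen M.edge))

/-- The noise variables are jointly independent. -/
def IndepNoise (M : SCM Ω 𝒩) : Prop :=
  iIndepFun (fun i (n : ∀ j, 𝒩 j) => n i) M.noise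

/-- The unique solution of the structural assignments at a noise vector `n`. -/
noncomputable def sol [Finite ι] (M : SCM Ω 𝒩) (n : ∀ i, 𝒩 i) : ∀ i, Ω i :=
  M.wf.fix fun i X => M.f i (fun j => X j.1 j.2) (n i)

theorem sol_eq [Finite ι] (M : SCM Ω 𝒩) (n : ∀ i, 𝒩 i) (i : ι) :
    M.sol n i = M.f i (fun j => M.sol n j.1) (n i) :=
  M.wf.fix_eq _ i

theorem measurable_sol [Finite ι] (M : SCM Ω 𝒩) : Measurable M.sol := by
  refine measurable_pi_lambda _ fun i => ?_
  induction i using M.wf.induction with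
  | _ i ih =>
    simp_rw [sol_eq M _ i]
    exact (M.measurable_f i).comp
      ((measurable_pi_lambda _ fun j => ih j.1 j.2).prodMk (measurable_pi_apply i))

/-- The observational distribution: the joint law of all nodes. -/
noncomputable def law [Finite ι] (M : SCM Ω 𝒩) : Measure (∀ i, Ω i) :=
  M.noise.map M.sol

instance [Finite ι] (M : SCM Ω 𝒩) : IsProbabilityMeasure M.law :=
  Measure.isProbabilityMeasure_map M.measurable_sol.aemeasurable

open Classical in
/-- The intervention `do(X i = x)`: the arrows into `i` are removed, the assignment of `i` is
replaced by the constant `x`, everything else is kept. -/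
noncomputable def doInt (M : SCM Ω 𝒩) (i : ι) (x : Ω i) : SCM Ω 𝒩 where
  edge j k := M.edge j k ∧ k ≠ i
  acyclic k h := M.acyclic k (Relation.TransGen.mono (fun _ _ e => e.1) _ _ h)
  f k p n := if h : k = i then h.symm ▸ x else M.f k (fun j => p ⟨j.1, j.2, h⟩) n
  measurable_f k := by
    by_cases h : k = i
    · subst h
      simp only [dif_pos]
      exact measurable_const
    · simp only [h, dite_false]
      have hg : Measurable fun q : ((j : {j // M.edge j k ∧ k ≠ i}) → Ω j.1) × 𝒩 k =>
          ((fun j : {j // M.edge j k} => q.1 ⟨j.1, j.2, h⟩), q.2) :=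
        (measurable_pi_lambda _ fun j =>
          (measurable_pi_apply _).comp measurable_fst).prodMk measurable_snd
      exact (M.measurable_f k).comp hg
  noise := M.noise
  isProb := M.isProb

/-- The counterfactual model given the observation `X j = x`: the assignments are kept and the
noise law is replaced by its (regular) conditional law given `X j = x`. -/
noncomputable def counterfactual [Finite ι] [∀ i, StandardBorelSpace (𝒩 i)] [∀ i, Nonempty (𝒩 i)]
    (M : SCM Ω 𝒩) (j : ι) (x : Ω j) : SCM Ω 𝒩 where
  edge := M.edge
  acyclic := M.acyclic
  f := M.f
  measurable_f := M.measurable_f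
  noise := condDistrib id (fun n => M.sol n j) M.noise x
  isProb := inferInstance

end Basic

section Distances

variable {ι : Type*} [Fintype ι] {Ω 𝒩₁ 𝒩₂ : ι → Type*} [∀ i, MeasurableSpace (Ω i)]
  [∀ i, MeasurableSpace (𝒩₁ i)] [∀ i, MeasurableSpace (𝒩₂ i)]

/-- The observational distance of two models, for a distance `D` between distributions. -/
noncomputable def OD (D : Measure (∀ i, Ω i) → Measure (∀ i, Ω i) → ℝ≥0∞)
    (M₁ : SCM Ω 𝒩₁) (M₂ : SCM Ω 𝒩₂) : ℝ≥0∞ :=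
  D M₁.law M₂.law

/-- The interventional distance: the distance of the joint laws after the single-node intervention
`do(X i = x)`, averaged over the nodes `i` and over values `x` drawn from `μ i`. -/
noncomputable def ID (D : Measure (∀ i, Ω i) → Measure (∀ i, Ω i) → ℝ≥0∞)
    (μ : ∀ i, Measure (Ω i)) (M₁ : SCM Ω 𝒩₁) (M₂ : SCM Ω 𝒩₂) : ℝ≥0∞ :=
  (Fintype.card ι : ℝ≥0∞)⁻¹ *
    ∑ i, ∫⁻ x, D (M₁.doInt i x).law (M₂.doInt i x).law ∂(μ i)

/-- The counterfactual distance: the interventional distance of the counterfactual models given a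
single-node observation `X j = x`, averaged over the nodes `j` and over values `x` drawn from
`ν j`. -/
noncomputable def CD (D : Measure (∀ i, Ω i) → Measure (∀ i, Ω i) → ℝ≥0∞)
    (μ ν : ∀ i, Measure (Ω i))
    [∀ i, StandardBorelSpace (𝒩₁ i)] [∀ i, Nonempty (𝒩₁ i)]
    [∀ i, StandardBorelSpace (𝒩₂ i)] [∀ i, Nonempty (𝒩₂ i)]
    (M₁ : SCM Ω 𝒩₁) (M₂ : SCM Ω 𝒩₂) : ℝ≥0∞ :=
  (Fintype.card ι : ℝ≥0∞)⁻¹ *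
    ∑ j, ∫⁻ x, ID D μ (M₁.counterfactual j x) (M₂.counterfactual j x) ∂(ν j)

end Distances

/-- Pairwise positivity with respect to reference measures `ref i`: the joint law of any two
distinct nodes charges every set that is not null for the product of their reference measures. -/
def PairPositive {ι : Type*} [Finite ι] {Ω 𝒩 : ι → Type*}
    [∀ i, MeasurableSpace (Ω i)] [∀ i, MeasurableSpace (𝒩 i)]
    (ref : ∀ i, Measure (Ω i)) (M : SCM Ω 𝒩) : Prop :=
  ∀ i j, i ≠ j → (ref i).prod (ref j) ≪ M.law.map (fun x => (x i, x j))

end SCM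

/-!
The two assertions rest on different ideas.

*Interventions determine observations.* By independence of the noises, each node `i` has a mechanism
that is a Markov kernel from the values of its parents (`SCM.nodeKernel`), and where everything has
densities the observational density is the product of the node densities `a i`, while the density of
the law in which node `i` alone is randomized is the product of `a j` over `j ≠ i`. The product over
`i` of the latter densities is the `(d - 1)`-st power of the observational density, where `d` is the
number of nodes, so for `d ≥ 2` the single-node interventions determine it (`SCM.prod_prod_erase`,
`SCM.law_eq_of_doInt_law_eq`). No relation between the two graphs is needed. Interventional laws
need not have densities, since an intervention may force parents to values that are never observed
together. Therefore `a i` is the density of the absolutely continuous part of the mechanism, and all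
laws are compared on the conull set of vectors that avoid the carriers of the singular parts
(`SCM.nodeRegular`). The comparison replaces the mechanisms by independent draws from the reference
measure one node at a time (`SCM.lintegral_hybridLaw_insert`), so no topological order of the graph
is needed.

*Counterfactuals determine interventions.* Averaging the counterfactual interventional laws over the
observed value of a node `j` yields the interventional law (`SCM.doInt_law_eq_bind`), so it suffices
to find one node `j` that has the same law in both models. Let `j` be a source of the first graph.
Interventions on the other nodes do not affect it. This can be read off the counterfactual laws, so
`j` has the same property in the second model (`SCM.EffectiveSource.transfer`), although it may have
parents there. Such a node is almost surely a function of its own noise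
(`exists_ae_eq_of_invariant`). Hence conditioning on it and intervening on it are the same, and
counterfactuals determine the conditional law of any other node `i` given `j`. As `j` is unaffected
by an intervention on `i`, they also determine the conditional law of `j` given `i`. Under pairwise
positivity the two conditional laws determine the joint law (`fst_eq_of_conditionals_eq`), in
particular the law of `j` (`SCM.marginal_eq_of_effectiveSource`).
-/

/-! ### Solutions with some nodes held fixed, and single-node interventions -/

namespace SCM

theorem not_reachable_of_edge {ι : Type*} {Ω 𝒩 : ι → Type*} [∀ i, MeasurableSpace (Ω i)]
    [∀ i, MeasurableSpace (𝒩 i)] (M : SCM Ω 𝒩) {i k : ι} (h : M.edge k i) :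
    ¬ Relation.ReflTransGen M.edge i k :=
  fun hk => M.acyclic i (Relation.TransGen.tail' hk h)

section PartialSolution

variable {ι : Type*} {Ω 𝒩 : ι → Type*}
  [∀ i, MeasurableSpace (Ω i)] [∀ i, MeasurableSpace (𝒩 i)] [Finite ι]

open Classical in
/-- The solution at the noise vector `n` when all nodes of `s` are held at the values prescribed by
`w`, and the remaining nodes follow their assignments. -/
noncomputable def partialSol (M : SCM Ω 𝒩) (s : Finset ι) (n : ∀ i, 𝒩 i) (w : ∀ i, Ω i) :
    ∀ i, Ω i :=
  M.wf.fix fun i X => if i ∈ s then w i else M.f i (fun j => X j.1 j.2) (n i)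

variable (M : SCM Ω 𝒩) {s : Finset ι} {i : ι}

theorem partialSol_eq_ite [DecidableEq ι] (s : Finset ι) (n : ∀ i, 𝒩 i) (w : ∀ i, Ω i) (i : ι) :
    M.partialSol s n w i =
      if i ∈ s then w i else M.f i (fun j => M.partialSol s n w j.1) (n i) := by
  rw [partialSol, M.wf.fix_eq]
  congr

theorem partialSol_of_mem (hi : i ∈ s) (n : ∀ i, 𝒩 i) (w : ∀ i, Ω i) :
    M.partialSol s n w i = w i := by
  classical rw [partialSol_eq_ite, if_pos hi]

theorem partialSol_of_notMem (hi : i ∉ s) (n : ∀ i, 𝒩 i) (w : ∀ i, Ω i) :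
    M.partialSol s n w i = M.f i (fun j => M.partialSol s n w j.1) (n i) := by
  classical rw [partialSol_eq_ite, if_neg hi]

theorem eq_partialSol {n : ∀ i, 𝒩 i} {w X : ∀ i, Ω i} (h₁ : ∀ i ∈ s, X i = w i)
    (h₂ : ∀ i ∉ s, X i = M.f i (fun j => X j.1) (n i)) : X = M.partialSol s n w := by
  funext i
  induction i using M.wf.induction with
  | _ i ih =>
    by_cases hi : i ∈ s
    · rw [h₁ i hi, partialSol_of_mem M hi]
    · rw [h₂ i hi, partialSol_of_notMem M hi]
      congr 1
      funext j
      exact ih j.1 j.2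

theorem partialSol_empty (n : ∀ i, 𝒩 i) (w : ∀ i, Ω i) : M.partialSol ∅ n w = M.sol n :=
  (eq_partialSol M (by simp) fun i _ => M.sol_eq n i).symm

theorem partialSol_univ {ι : Type*} {Ω 𝒩 : ι → Type*}
    [∀ i, MeasurableSpace (Ω i)] [∀ i, MeasurableSpace (𝒩 i)] [Fintype ι] (M : SCM Ω 𝒩)
    (n : ∀ i, 𝒩 i) (w : ∀ i, Ω i) : M.partialSol Finset.univ n w = w :=
  funext fun _ => partialSol_of_mem M (Finset.mem_univ _) n w

theorem measurable_partialSol (s : Finset ι) :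
    Measurable fun p : (∀ i, 𝒩 i) × (∀ i, Ω i) => M.partialSol s p.1 p.2 := by
  refine measurable_pi_lambda _ fun i => ?_
  induction i using M.wf.induction with
  | _ i ih =>
    by_cases hi : i ∈ s
    · simp_rw [partialSol_of_mem M hi]
      fun_prop
    · simp_rw [partialSol_of_notMem M hi]
      exact (M.measurable_f i).comp ((measurable_pi_lambda _ fun j => ih j.1 j.2).prodMk
        ((measurable_pi_apply i).comp measurable_fst))

/-- Two partial solutions agree at all nodes that cannot be reached from `i` if their data agree
away from `i`. -/
theorem partialSol_congr_of_not_reachable {s t : Finset ι} {n n' : ∀ i, 𝒩 i} {w w' : ∀ i, Ω i}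
    (hs : ∀ k ≠ i, (k ∈ s ↔ k ∈ t)) (hn : ∀ k ≠ i, n k = n' k) (hw : ∀ k ≠ i, w k = w' k)
    {k : ι} (hk : ¬ Relation.ReflTransGen M.edge i k) :
    M.partialSol s n w k = M.partialSol t n' w' k := by
  induction k using M.wf.induction with
  | _ k ih =>
    have hki : k ≠ i := by rintro rfl; exact hk .refl
    by_cases h : k ∈ s
    · rw [partialSol_of_mem M h, partialSol_of_mem M ((hs k hki).1 h), hw k hki]
    · rw [partialSol_of_notMem M h, partialSol_of_notMem M (mt (hs k hki).2 h), hn k hki]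
      congr 1
      funext j
      exact ih j.1 j.2 fun hj => hk (hj.tail j.2)

variable [DecidableEq ι]

theorem partialSol_update_noise (hi : i ∈ s) (n : ∀ i, 𝒩 i) (w : ∀ i, Ω i) (m : 𝒩 i) :
    M.partialSol s (Function.update n i m) w = M.partialSol s n w := by
  refine eq_partialSol M (fun k hk => partialSol_of_mem M hk _ _) fun k hk => ?_
  have hki : k ≠ i := by rintro rfl; exact hk hi
  rw [partialSol_of_notMem M hk, Function.update_of_ne hki]

/-- Holding a further node at the value that it has anyway changes nothing. -/
theorem partialSol_insert (hi : i ∉ s) (n : ∀ i, 𝒩 i) (w : ∀ i, Ω i) :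
    M.partialSol (insert i s) n (Function.update w i (M.partialSol s n w i)) =
      M.partialSol s n w := by
  symm
  refine eq_partialSol M (fun k hk => ?_) fun k hk => ?_
  · rcases Finset.mem_insert.1 hk with rfl | hk'
    · simp
    · have hki : k ≠ i := by rintro rfl; exact hi hk'
      rw [partialSol_of_mem M hk', Function.update_of_ne hki]
  · exact partialSol_of_notMem M (fun h => hk (Finset.mem_insert_of_mem h)) _ _

end PartialSolution

section Intervention

variable {ι : Type*} {Ω 𝒩 : ι → Type*}
  [∀ i, MeasurableSpace (Ω i)] [∀ i, MeasurableSpace (𝒩 i)] [Finite ι] (M : SCM Ω 𝒩)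

theorem doInt_sol (i : ι) (x : Ω i) (n : ∀ i, 𝒩 i) (w : ∀ i, Ω i) (hw : w i = x) :
    (M.doInt i x).sol n = M.partialSol {i} n w := by
  refine eq_partialSol M (fun k hk => ?_) fun k hk => ?_
  · obtain rfl := Finset.mem_singleton.1 hk
    rw [sol_eq]
    simp [doInt, hw]
  · have hk' : k ≠ i := by simpa using hk
    rw [sol_eq]
    simp [doInt, hk']

theorem doInt_sol_self (i : ι) (x : Ω i) (n : ∀ i, 𝒩 i) : (M.doInt i x).sol n i = x := by
  classical
  rw [M.doInt_sol i x n (Function.update (M.sol n) i x) (by simp),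
    partialSol_of_mem M (by simp), Function.update_self]

theorem measurable_doInt_sol (i : ι) :
    Measurable fun p : Ω i × (∀ i, 𝒩 i) => (M.doInt i p.1).sol p.2 := by
  classical
  have h : (fun p : Ω i × (∀ i, 𝒩 i) => (M.doInt i p.1).sol p.2) = fun p =>
      M.partialSol {i} p.2 (Function.update (M.sol p.2) i p.1) :=
    funext fun p => M.doInt_sol i p.1 p.2 _ (by simp)
  rw [h]
  refine (M.measurable_partialSol {i}).comp (measurable_snd.prodMk ?_)
  exact measurable_update'.comp ((M.measurable_sol.comp measurable_snd).prodMk measurable_fst)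

/-- The intervention on node `i` makes the noise of node `i` irrelevant. -/
theorem doInt_sol_update [DecidableEq ι] (i : ι) (x : Ω i) (n : ∀ i, 𝒩 i) (m : 𝒩 i) :
    (M.doInt i x).sol (Function.update n i m) = (M.doInt i x).sol n := by
  have hw : Function.update (M.sol n) i x i = x := by simp
  rw [M.doInt_sol i x _ _ hw, M.doInt_sol i x _ _ hw, partialSol_update_noise M (by simp)]

/-- Consistency: setting a node to its factual value reproduces the factual solution. -/
theorem doInt_sol_sol (i : ι) (n : ∀ i, 𝒩 i) : (M.doInt i (M.sol n i)).sol n = M.sol n := by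
  classical
  have h := M.partialSol_insert (s := ∅) (i := i) (by simp) n (M.sol n)
  rw [partialSol_empty] at h
  rw [M.doInt_sol i _ n (Function.update (M.sol n) i (M.sol n i)) (by simp)]
  exact h

/-- Intervening on another node does not affect a source of the graph. -/
theorem doInt_sol_of_source {i j : ι} (hij : i ≠ j) (hj : ∀ k, ¬ M.edge k j) (x : Ω i)
    (n : ∀ i, 𝒩 i) : (M.doInt i x).sol n j = M.sol n j := by
  classical
  have hr : ¬ Relation.ReflTransGen M.edge i j := by
    intro h
    rcases Relation.ReflTransGen.cases_tail h with h | ⟨k, -, hk⟩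
    · exact hij h.symm
    · exact hj k hk
  rw [M.doInt_sol i x n (Function.update (M.sol n) i x) (by simp),
    ← M.partialSol_empty n (M.sol n)]
  refine partialSol_congr_of_not_reachable M (fun k hk => by simp [hk]) (fun _ _ => rfl)
    (fun k hk => Function.update_of_ne hk _ _) hr

theorem exists_source [Nonempty ι] : ∃ j, ∀ k, ¬ M.edge k j := by
  obtain ⟨j, -, hj⟩ := M.wf.has_min Set.univ Set.univ_nonempty
  exact ⟨j, fun k => hj k (Set.mem_univ k)⟩

end Intervention

end SCM

/-! ### Product measures and conditional laws -/

/-- A function on a product that is unchanged by updates of all coordinates other than `j` depends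
on coordinate `j` only. -/
theorem eq_of_forall_update_eq {ι : Type*} [Fintype ι] [DecidableEq ι] {α : ι → Type*}
    {E : Type*} {ψ : (∀ i, α i) → E} {j : ι}
    (h : ∀ i ≠ j, ∀ x y, ψ (Function.update x i y) = ψ x) {x x' : ∀ i, α i} (hx : x j = x' j) :
    ψ x = ψ x' := by
  have H : ∀ s : Finset ι, j ∉ s → ψ (s.piecewise x' x) = ψ x := by
    intro s
    induction s using Finset.induction_on with
    | empty => simp
    | insert i s hi ih =>
      intro hj
      rw [Finset.piecewise_insert, h i (by rintro rfl; exact hj (Finset.mem_insert_self _ _)),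
        ih fun h => hj (Finset.mem_insert_of_mem h)]
  rw [← H (Finset.univ.erase j) (by simp)]
  congr 1
  funext k
  by_cases hk : k = j
  · subst hk
    simp [hx]
  · simp [hk]

section ProductMeasures

variable {ι : Type*} [Fintype ι] {α : ι → Type*} [∀ i, MeasurableSpace (α i)]

/-- Resampling one coordinate of a product probability measure preserves it. -/
theorem measurePreserving_update_pi [DecidableEq ι] (ρ : ∀ i, Measure (α i))
    [∀ i, IsProbabilityMeasure (ρ i)] (i : ι) :
    MeasurePreserving (fun p : (∀ i, α i) × α i => Function.update p.1 i p.2)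
      ((Measure.pi ρ).prod (ρ i)) (Measure.pi ρ) := by
  refine ⟨measurable_update', (Measure.pi_eq fun s hs => ?_).symm⟩
  have hpre : (fun p : (∀ i, α i) × α i => Function.update p.1 i p.2) ⁻¹' Set.univ.pi s =
      (Set.univ.pi (Function.update s i Set.univ)) ×ˢ s i := by
    ext ⟨x, y⟩
    simp only [Set.mem_preimage, Set.mem_univ_pi, Set.mem_prod]
    constructor
    · refine fun h => ⟨fun k => ?_, by simpa using h i⟩
      rcases eq_or_ne k i with rfl | hk
      · simp
      · simpa [hk] using h k
    · rintro ⟨h₁, h₂⟩ k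
      rcases eq_or_ne k i with rfl | hk
      · simpa using h₂
      · simpa [hk] using h₁ k
  rw [Measure.map_apply measurable_update' (.univ_pi hs), hpre, Measure.prod_prod, Measure.pi_pi,
    ← Finset.mul_prod_erase _ _ (Finset.mem_univ i),
    ← Finset.mul_prod_erase Finset.univ (fun k => ρ k (s k)) (Finset.mem_univ i)]
  simp only [Function.update_self, measure_univ, one_mul]
  rw [mul_comm]
  congr 1
  refine Finset.prod_congr rfl fun k hk => ?_
  rw [Function.update_of_ne (Finset.ne_of_mem_erase hk)]

theorem lintegral_pi_eq_lintegral_update [DecidableEq ι] (ρ : ∀ i, Measure (α i))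
    [∀ i, IsProbabilityMeasure (ρ i)] (i : ι) {g : (∀ i, α i) → ℝ≥0∞} (hg : Measurable g) :
    ∫⁻ x, g x ∂(Measure.pi ρ) = ∫⁻ x, ∫⁻ y, g (Function.update x i y) ∂(ρ i) ∂(Measure.pi ρ) := by
  rw [← (measurePreserving_update_pi ρ i).lintegral_comp hg]
  exact lintegral_prod _ (hg.comp measurable_update').aemeasurable

theorem absolutelyContinuous_pi {ρ ρ' : ∀ i, Measure (α i)} [∀ i, SigmaFinite (ρ i)]
    [∀ i, IsProbabilityMeasure (ρ' i)] (h : ∀ i, ρ i ≪ ρ' i) :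
    Measure.pi ρ ≪ Measure.pi ρ' := by
  set g : ∀ i, α i → ℝ≥0∞ := fun i => (ρ i).rnDeriv (ρ' i) with hg
  have hgm : ∀ i, Measurable (g i) := fun i => Measure.measurable_rnDeriv _ _
  have key : Measure.pi ρ = (Measure.pi ρ').withDensity fun x => ∏ i, g i (x i) := by
    refine Measure.pi_eq fun s hs => ?_
    have hprod : ∀ x : ∀ i, α i, (Set.univ.pi s).indicator (fun x => ∏ i, g i (x i)) x =
        ∏ i, (s i).indicator (g i) (x i) := by
      intro x
      by_cases hx : x ∈ Set.univ.pi s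
      · rw [Set.indicator_of_mem hx]
        exact Finset.prod_congr rfl fun i _ => (Set.indicator_of_mem (hx i trivial) _).symm
      · rw [Set.indicator_of_notMem hx]
        obtain ⟨i, hi⟩ : ∃ i, x i ∉ s i := by simpa using hx
        exact (Finset.prod_eq_zero (Finset.mem_univ i) (Set.indicator_of_notMem hi _)).symm
    rw [withDensity_apply _ (.univ_pi hs), ← lintegral_indicator (.univ_pi hs)]
    simp_rw [hprod]
    have hind : iIndepFun (fun i (x : ∀ i, α i) => (s i).indicator (g i) (x i))
        (Measure.pi ρ') :=
      iIndepFun_pi (X := fun i => (s i).indicator (g i))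
        fun i => ((hgm i).indicator (hs i)).aemeasurable
    rw [lintegral_prod_eq_prod_lintegral_of_indepFun Finset.univ _ hind
      fun i => ((hgm i).indicator (hs i)).comp (measurable_pi_apply i)]
    refine Finset.prod_congr rfl fun i _ => ?_
    rw [(measurePreserving_eval ρ' i).lintegral_comp ((hgm i).indicator (hs i)),
      lintegral_indicator (hs i), ← withDensity_apply _ (hs i),
      Measure.withDensity_rnDeriv_eq _ _ (h i)]
  rw [key]
  exact withDensity_absolutelyContinuous _ _

/-- If a random variable on a product probability space agrees almost surely, for every coordinate
`i ≠ j`, with a function that does not depend on coordinate `i`, then it agrees almost surely with a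
function of coordinate `j` alone. -/
theorem exists_ae_eq_of_invariant [DecidableEq ι] (ρ : ∀ i, Measure (α i))
    [∀ i, IsProbabilityMeasure (ρ i)] {E : Type*} [MeasurableSpace E] [MeasurableEq E]
    {φ : (∀ i, α i) → E} (hφ : Measurable φ) (j : ι)
    (h : ∀ i ≠ j, ∃ ψ : (∀ i, α i) → E, Measurable ψ ∧ φ =ᵐ[Measure.pi ρ] ψ ∧
      ∀ x y, ψ (Function.update x i y) = ψ x) :
    ∃ ψ : α j → E, Measurable ψ ∧ φ =ᵐ[Measure.pi ρ] fun x => ψ (x j) := by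
  suffices H : ∀ s : Finset ι, j ∉ s → ∃ ψ : (∀ i, α i) → E, Measurable ψ ∧
      φ =ᵐ[Measure.pi ρ] ψ ∧ ∀ i ∈ s, ∀ x y, ψ (Function.update x i y) = ψ x by
    obtain ⟨ψ, h₁, h₂, h₃⟩ := H (Finset.univ.erase j) (by simp)
    obtain ⟨x₀⟩ := nonempty_of_isProbabilityMeasure (Measure.pi ρ)
    refine ⟨fun y => ψ (Function.update x₀ j y), h₁.comp (measurable_update x₀), ?_⟩
    filter_upwards [h₂] with x hx
    rw [hx]
    exact eq_of_forall_update_eq (j := j) (fun i hi => h₃ i (by simp [hi])) (by simp)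
  intro s
  induction s using Finset.induction_on with
  | empty => exact fun _ => ⟨φ, hφ, .rfl, by simp⟩
  | insert i s hi ih =>
    intro hj
    obtain ⟨θ, hθm, hθ, hθinv⟩ := ih fun h => hj (Finset.mem_insert_of_mem h)
    obtain ⟨ψ, hψm, hψ, hψinv⟩ := h i (by rintro rfl; exact hj (Finset.mem_insert_self _ _))
    have hθψ : θ =ᵐ[Measure.pi ρ] ψ := hθ.symm.trans hψ
    have hup : ∀ᵐ p ∂(Measure.pi ρ).prod (ρ i), θ (Function.update p.1 i p.2) = θ p.1 := by
      filter_upwards [(measurePreserving_update_pi ρ i).quasiMeasurePreserving.ae hθψ,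
        Measure.quasiMeasurePreserving_fst.ae hθψ] with p h₁ h₂
      rw [h₁, h₂, hψinv]
    have hms : MeasurableSet {p : (∀ i, α i) × α i | θ (Function.update p.1 i p.2) = θ p.1} :=
      measurableSet_eq_fun (hθm.comp measurable_update') (hθm.comp measurable_fst)
    -- almost every value `m` is such that freezing coordinate `i` at `m` does not change `θ` a.e.
    obtain ⟨m, hm⟩ : ∃ m, ∀ᵐ x ∂Measure.pi ρ, θ (Function.update x i m) = θ x :=
      ((Measure.ae_ae_comm hms).1 (Measure.ae_ae_of_ae_prod hup)).exists
    refine ⟨fun x => θ (Function.update x i m), hθm.comp measurable_update_left, ?_, ?_⟩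
    · filter_upwards [hθ, hm] with x h₁ h₂
      rw [h₁, h₂]
    · intro k hk x y
      rcases eq_or_ne k i with rfl | hki
      · simp
      · simp only
        rw [Function.update_comm hki, hθinv k ((Finset.mem_insert.1 hk).resolve_left hki)]

end ProductMeasures

/-- Changing the first marginal while keeping the conditional law multiplies the joint law by a
density of the first coordinate. -/
theorem compProd_eq_withDensity_compProd {α β : Type*} [MeasurableSpace α] [MeasurableSpace β]
    {μ μ' : Measure α} [IsFiniteMeasure μ] [IsFiniteMeasure μ'] (h : μ ≪ μ')
    (K : Kernel α β) [IsMarkovKernel K] :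
    μ ⊗ₘ K = (μ' ⊗ₘ K).withDensity fun p => μ.rnDeriv μ' p.1 := by
  have ham : Measurable (μ.rnDeriv μ') := Measure.measurable_rnDeriv _ _
  ext s hs
  have hms : Measurable fun x => K x (Prod.mk x ⁻¹' s) := Kernel.measurable_kernel_prodMk_left hs
  have hlhs : (μ ⊗ₘ K) s = ∫⁻ x, μ.rnDeriv μ' x * K x (Prod.mk x ⁻¹' s) ∂μ' := by
    rw [Measure.compProd_apply hs]
    conv_lhs => rw [← Measure.withDensity_rnDeriv_eq _ _ h]
    exact lintegral_withDensity_eq_lintegral_mul _ ham hms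
  have hg : Measurable (s.indicator fun p : α × β => μ.rnDeriv μ' p.1) :=
    (ham.comp measurable_fst).indicator hs
  rw [hlhs, withDensity_apply _ hs, ← lintegral_indicator hs, Measure.lintegral_compProd hg]
  refine lintegral_congr fun x => ?_
  rw [← lintegral_indicator_const (measurable_prodMk_left hs)]
  rfl

/-- Two laws `P` and `Q` on a product whose conditional laws agree in both directions have the same
first marginal, provided that the marginals of `Q` dominate those of `P` and that `Q` charges every
set charged by the product of its marginals: the density of `P` with respect to `Q` is a function of
either coordinate alone, hence constant. -/
theorem fst_eq_of_conditionals_eq {α β : Type*} [MeasurableSpace α] [MeasurableSpace β]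
    {P Q : Measure (α × β)} [IsProbabilityMeasure P] [IsProbabilityMeasure Q]
    (K : Kernel α β) [IsMarkovKernel K] (L : Kernel β α) [IsMarkovKernel L]
    (hPK : P = P.fst ⊗ₘ K) (hQK : Q = Q.fst ⊗ₘ K)
    (hPL : P.map Prod.swap = P.snd ⊗ₘ L) (hQL : Q.map Prod.swap = Q.snd ⊗ₘ L)
    (hfst : P.fst ≪ Q.fst) (hsnd : P.snd ≪ Q.snd) (hQ : Q.fst.prod Q.snd ≪ Q) :
    P.fst = Q.fst := by
  set a := P.fst.rnDeriv Q.fst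
  set b := P.snd.rnDeriv Q.snd
  have ham : Measurable a := Measure.measurable_rnDeriv _ _
  have hbm : Measurable b := Measure.measurable_rnDeriv _ _
  have hPa : P = Q.withDensity fun p => a p.1 := by
    rw [hPK]
    conv_rhs => rw [hQK]
    exact compProd_eq_withDensity_compProd hfst K
  have hPb' : P.map Prod.swap = (Q.map Prod.swap).withDensity fun p => b p.1 := by
    rw [hPL, hQL]
    exact compProd_eq_withDensity_compProd hsnd L
  have hPb : P = Q.withDensity fun p => b p.2 := by
    ext s hs
    have h1 := congrArg (fun m => m (Prod.swap ⁻¹' s)) hPb'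
    have hbm' : Measurable fun p : β × α => b p.1 := hbm.comp measurable_fst
    have hs' : MeasurableSet (Prod.swap ⁻¹' s : Set (β × α)) := measurable_swap hs
    rw [Measure.map_apply measurable_swap hs', withDensity_apply _ hs',
      setLIntegral_map hs' hbm' measurable_swap] at h1
    rw [withDensity_apply _ hs]
    exact h1
  have hab : ∀ᵐ p ∂Q, a p.1 = b p.2 := by
    have : (fun p : α × β => a p.1) =ᵐ[Q] fun p => b p.2 := by
      rw [← withDensity_eq_iff_of_sigmaFinite (by fun_prop) (by fun_prop), ← hPa, ← hPb]
    exact this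
  have hab' : ∀ᵐ x ∂Q.fst, ∀ᵐ y ∂Q.snd, a x = b y := Measure.ae_ae_of_ae_prod (hQ.ae_le hab)
  have hms : MeasurableSet {p : α × β | a p.1 = b p.2} :=
    measurableSet_eq_fun (ham.comp measurable_fst) (hbm.comp measurable_snd)
  obtain ⟨y, hy⟩ := ((Measure.ae_ae_comm hms).1 hab').exists
  have hPQ : P.fst = b y • Q.fst := by
    rw [← Measure.withDensity_rnDeriv_eq _ _ hfst, ← withDensity_const]
    exact withDensity_congr_ae hy
  have hone : b y = 1 := by
    have := congrArg (fun m => m Set.univ) hPQ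
    simpa using this.symm
  rw [hPQ, hone, one_smul]

/-! ### Observational laws from interventional laws -/

namespace SCM

section NodeKernel

variable {ι : Type*} {Ω 𝒩 : ι → Type*}
  [∀ i, MeasurableSpace (Ω i)] [∀ i, MeasurableSpace (𝒩 i)] (M : SCM Ω 𝒩)

/-- The law of the noise variable of node `i`. -/
noncomputable def noiseLaw (i : ι) : Measure (𝒩 i) := M.noise.map fun n => n i

instance (i : ι) : IsProbabilityMeasure (M.noiseLaw i) :=
  Measure.isProbabilityMeasure_map (measurable_pi_apply i).aemeasurable

theorem noise_eq_pi [Fintype ι] (hind : M.IndepNoise) : M.noise = Measure.pi M.noiseLaw := by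
  have h := (iIndepFun_iff_map_fun_eq_pi_map fun i => (measurable_pi_apply i).aemeasurable).1 hind
  rwa [Measure.map_id'] at h

/-- The mechanism of node `i` as a Markov kernel: the law of `f i z` applied to the noise of node
`i`, for each value `z` of the parents. -/
noncomputable def nodeKernel (i : ι) : Kernel ((j : {j // M.edge j i}) → Ω j.1) (Ω i) :=
  (Kernel.id ×ₖ Kernel.const _ (M.noiseLaw i)).map (Function.uncurry (M.f i))

instance (i : ι) : IsMarkovKernel (M.nodeKernel i) :=
  Kernel.IsMarkovKernel.map _ (M.measurable_f i)

theorem lintegral_nodeKernel (i : ι) (z : (j : {j // M.edge j i}) → Ω j.1) {g : Ω i → ℝ≥0∞}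
    (hg : Measurable g) :
    ∫⁻ x, g x ∂(M.nodeKernel i z) = ∫⁻ m, g (M.f i z m) ∂(M.noiseLaw i) := by
  rw [nodeKernel, Kernel.lintegral_map _ (M.measurable_f i) _ hg, Kernel.prod_apply,
    Kernel.id_apply, Kernel.const_apply, Measure.dirac_prod]
  exact lintegral_map (hg.comp (M.measurable_f i)) measurable_prodMk_left

variable [∀ i, StandardBorelSpace (Ω i)]
  (ν : ∀ i, Measure (Ω i))

/-- The density with respect to `ν i` of the absolutely continuous part of the mechanism of node
`i`, as a function of the values of all nodes. -/
noncomputable def nodeDensity (i : ι) (x : ∀ i, Ω i) : ℝ≥0∞ :=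
  Kernel.rnDeriv (M.nodeKernel i) (Kernel.const _ (ν i)) (fun j => x j.1) (x i)

/-- The value vectors at which the value of node `i` avoids the `ν i`-null set carrying the singular
part of its mechanism, given the values of the parents. -/
def nodeRegular (i : ι) : Set (∀ i, Ω i) :=
  {x | ((fun j => x j.1 : (j : {j // M.edge j i}) → Ω j.1), x i) ∉
    Kernel.mutuallySingularSet (M.nodeKernel i) (Kernel.const _ (ν i))}

theorem measurable_nodeDensity (i : ι) : Measurable (M.nodeDensity ν i) := by
  have h : Measurable fun x : ∀ i, Ω i =>
      ((fun j => x j.1 : (j : {j // M.edge j i}) → Ω j.1), x i) := by fun_prop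
  exact (Kernel.measurable_rnDeriv (M.nodeKernel i) (Kernel.const _ (ν i))).comp h

theorem measurableSet_nodeRegular (i : ι) : MeasurableSet (M.nodeRegular ν i) := by
  have h : Measurable fun x : ∀ i, Ω i =>
      ((fun j => x j.1 : (j : {j // M.edge j i}) → Ω j.1), x i) := by fun_prop
  exact h (Kernel.measurableSet_mutuallySingularSet _ _).compl

/-- Off the carrier of its singular part, the mechanism has the density of its absolutely continuous
part. -/
theorem restrict_nodeKernel [∀ i, IsProbabilityMeasure (ν i)] (i : ι)
    (z : (j : {j // M.edge j i}) → Ω j.1) :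
    (M.nodeKernel i z).restrict
      (Kernel.mutuallySingularSetSlice (M.nodeKernel i) (Kernel.const _ (ν i)) z)ᶜ =
    (ν i).withDensity (Kernel.rnDeriv (M.nodeKernel i) (Kernel.const _ (ν i)) z) := by
  set κ := M.nodeKernel i
  set η : Kernel ((j : {j // M.edge j i}) → Ω j.1) (Ω i) := Kernel.const _ (ν i)
  set S := Kernel.mutuallySingularSetSlice κ η z
  have hS : MeasurableSet S := Kernel.measurableSet_mutuallySingularSetSlice κ η z
  have hd : ∀ s, (ν i).withDensity (Kernel.rnDeriv κ η z) s =
      Kernel.withDensity η (Kernel.rnDeriv κ η) z s := fun s => by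
    rw [Kernel.withDensity_apply _ (Kernel.measurable_rnDeriv κ η)]
    rfl
  ext s hs
  rw [Measure.restrict_apply hs, hd, ← Set.sdiff_eq,
    ← Kernel.withDensity_rnDeriv_of_subset_compl_mutuallySingularSetSlice (hs.diff hS)
      (fun _ hx => hx.2)]
  exact measure_sdiff_null (Kernel.withDensity_rnDeriv_mutuallySingularSetSlice κ η z)

end NodeKernel

section Hybrid

variable {ι : Type*} [Fintype ι] {Ω 𝒩 : ι → Type*}
  [∀ i, MeasurableSpace (Ω i)] [∀ i, MeasurableSpace (𝒩 i)] (M : SCM Ω 𝒩)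
  (ν : ∀ i, Measure (Ω i)) [∀ i, IsProbabilityMeasure (ν i)]

/-- The joint law of all nodes when the nodes of `s` are replaced by independent variables with
laws `ν i`, and the remaining nodes keep their mechanisms. -/
noncomputable def hybridLaw (s : Finset ι) : Measure (∀ i, Ω i) :=
  (M.noise.prod (Measure.pi ν)).map fun p => M.partialSol s p.1 p.2

instance (s : Finset ι) : IsProbabilityMeasure (M.hybridLaw ν s) :=
  Measure.isProbabilityMeasure_map (M.measurable_partialSol s).aemeasurable

theorem lintegral_hybridLaw (s : Finset ι) {g : (∀ i, Ω i) → ℝ≥0∞} (hg : Measurable g) :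
    ∫⁻ x, g x ∂(M.hybridLaw ν s) =
      ∫⁻ n, ∫⁻ w, g (M.partialSol s n w) ∂(Measure.pi ν) ∂M.noise := by
  rw [hybridLaw, lintegral_map hg (M.measurable_partialSol s)]
  exact lintegral_prod _ (hg.comp (M.measurable_partialSol s)).aemeasurable

theorem hybridLaw_empty : M.hybridLaw ν ∅ = M.law := by
  have h : (fun p : (∀ i, 𝒩 i) × (∀ i, Ω i) => M.partialSol ∅ p.1 p.2) = M.sol ∘ Prod.fst :=
    funext fun p => M.partialSol_empty p.1 p.2
  rw [hybridLaw, h, ← Measure.map_map M.measurable_sol measurable_fst,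
    measurePreserving_fst.map_eq, law]

theorem hybridLaw_univ : M.hybridLaw ν Finset.univ = Measure.pi ν := by
  have h : (fun p : (∀ i, 𝒩 i) × (∀ i, Ω i) => M.partialSol Finset.univ p.1 p.2) = Prod.snd :=
    funext fun p => M.partialSol_univ p.1 p.2
  rw [hybridLaw, h, measurePreserving_snd.map_eq]

theorem measurable_doInt_law (i : ι) : Measurable fun y => (M.doInt i y).law := by
  refine Measure.measurable_of_measurable_coe _ fun s hs => ?_
  have h : ∀ y, (M.doInt i y).law s =
      M.noise (Prod.mk y ⁻¹' ((fun p : Ω i × (∀ i, 𝒩 i) => (M.doInt i p.1).sol p.2) ⁻¹' s)) :=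
    fun y => Measure.map_apply (M.doInt i y).measurable_sol hs
  simp_rw [h]
  exact measurable_measure_prodMk_left (M.measurable_doInt_sol i hs)

/-- Randomizing a single node is the mixture of the interventions on it. -/
theorem hybridLaw_singleton (i : ι) :
    M.hybridLaw ν {i} = (ν i).bind fun y => (M.doInt i y).law := by
  refine Measure.ext_of_lintegral _ fun g hg => ?_
  have hjoint : Measurable fun p : (∀ i, 𝒩 i) × Ω i => g ((M.doInt i p.2).sol p.1) :=
    hg.comp ((M.measurable_doInt_sol i).comp measurable_swap)
  rw [lintegral_hybridLaw _ _ _ hg,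
    Measure.lintegral_bind (M.measurable_doInt_law i).aemeasurable hg.aemeasurable]
  have h₁ : ∀ n, ∫⁻ w, g (M.partialSol {i} n w) ∂(Measure.pi ν) =
      ∫⁻ y, g ((M.doInt i y).sol n) ∂(ν i) := fun n => by
    simp_rw [← fun w => M.doInt_sol i _ n w rfl]
    exact (measurePreserving_eval ν i).lintegral_comp (hjoint.comp measurable_prodMk_left)
  simp_rw [h₁]
  rw [lintegral_lintegral_swap hjoint.aemeasurable]
  exact lintegral_congr fun y => (lintegral_map hg (M.doInt i y).measurable_sol).symm

variable [∀ i, StandardBorelSpace (Ω i)]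

/-- The single-node step with all other noises and values fixed: averaging over the noise of node
`i`, on the regular values, is averaging over a value drawn from `ν i`, weighted with the node
density. -/
theorem lintegral_noiseLaw_update [DecidableEq ι] {s : Finset ι} {i : ι}
    (hi : i ∉ s) {h : (∀ i, Ω i) → ℝ≥0∞} (hh : Measurable h) (n : ∀ i, 𝒩 i) (w : ∀ i, Ω i) :
    ∫⁻ m, (M.nodeRegular ν i).indicator h
        (M.partialSol s (Function.update n i m) w) ∂(M.noiseLaw i) =
      ∫⁻ x, h (M.partialSol (insert i s) n (Function.update w i x)) *
        M.nodeDensity ν i (M.partialSol (insert i s) n (Function.update w i x)) ∂(ν i) := by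
  set X : Ω i → ∀ i, Ω i := fun x => M.partialSol (insert i s) n (Function.update w i x) with hX
  have hXm : Measurable X := (M.measurable_partialSol (insert i s)).comp
    (measurable_const.prodMk (measurable_update w))
  -- the values of the parents of `i` depend neither on the noise nor on the value of `i`
  set z : (j : {j // M.edge j i}) → Ω j.1 := fun j => M.partialSol (insert i s) n w j.1 with hz
  have hz₁ : ∀ m, (fun j : {j // M.edge j i} =>
      M.partialSol s (Function.update n i m) w j.1) = z := fun m => by
    funext j
    exact M.partialSol_congr_of_not_reachable (i := i) (fun l hl => by simp [hl])
      (fun l hl => by simp [hl]) (fun l _ => rfl) (M.not_reachable_of_edge j.2)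
  have hz₂ : ∀ x, (fun j : {j // M.edge j i} => X x j.1) = z := fun x => by
    funext j
    exact M.partialSol_congr_of_not_reachable (i := i) (fun l _ => Iff.rfl)
      (fun l _ => rfl) (fun l hl => by simp [hl]) (M.not_reachable_of_edge j.2)
  have hxi : ∀ x, X x i = x := fun x => by
    rw [hX]
    simp only
    rw [M.partialSol_of_mem (Finset.mem_insert_self i s), Function.update_self]
  have hsol : ∀ m, M.partialSol s (Function.update n i m) w = X (M.f i z m) := fun m => by
    have hval : M.partialSol s (Function.update n i m) w i = M.f i z m := by
      rw [M.partialSol_of_notMem hi, Function.update_self, hz₁]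
    rw [← M.partialSol_insert hi, hval, M.partialSol_update_noise (Finset.mem_insert_self i s)]
  set S := Kernel.mutuallySingularSetSlice (M.nodeKernel i) (Kernel.const _ (ν i)) z with hS
  have hSm : MeasurableSet S := Kernel.measurableSet_mutuallySingularSetSlice _ _ z
  have hφm : Measurable fun x => h (X x) := hh.comp hXm
  have hpre : X ⁻¹' M.nodeRegular ν i = Sᶜ := by
    ext x
    simp only [nodeRegular, Set.mem_preimage, Set.mem_ofPred_eq, hz₂, hxi]
    rfl
  have hdens : ∀ x, M.nodeDensity ν i (X x) =
      Kernel.rnDeriv (M.nodeKernel i) (Kernel.const _ (ν i)) z x := fun x => by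
    simp only [nodeDensity, hz₂, hxi]
  have hleft : ∀ x, (M.nodeRegular ν i).indicator h (X x) = Sᶜ.indicator (fun x => h (X x)) x := by
    intro x
    rw [← hpre]
    rfl
  simp_rw [hsol, hleft]
  change _ = ∫⁻ x, h (X x) * M.nodeDensity ν i (X x) ∂(ν i)
  simp_rw [hdens]
  rw [← M.lintegral_nodeKernel i z (hφm.indicator hSm.compl), lintegral_indicator hSm.compl,
    M.restrict_nodeKernel ν i z, lintegral_withDensity_eq_lintegral_mul _
      (Kernel.measurable_rnDeriv_right _ _ z) hφm]
  exact lintegral_congr fun x => mul_comm _ _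

/-- Replacing the mechanism of a single node by an independent draw from `ν i`, on the regular
values of that node, amounts to a multiplication by the node density. -/
theorem lintegral_hybridLaw_insert [DecidableEq ι] (hind : M.IndepNoise) {s : Finset ι} {i : ι}
    (hi : i ∉ s) {h : (∀ i, Ω i) → ℝ≥0∞} (hh : Measurable h) :
    ∫⁻ x, (M.nodeRegular ν i).indicator h x ∂(M.hybridLaw ν s) =
      ∫⁻ x, h x * M.nodeDensity ν i x ∂(M.hybridLaw ν (insert i s)) := by
  have hg : Measurable ((M.nodeRegular ν i).indicator h) :=
    hh.indicator (M.measurableSet_nodeRegular ν i)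
  have hd : Measurable fun x => h x * M.nodeDensity ν i x := hh.mul (M.measurable_nodeDensity ν i)
  have hgj : Measurable fun p : (∀ i, 𝒩 i) × (∀ i, Ω i) =>
      (M.nodeRegular ν i).indicator h (M.partialSol s p.1 p.2) :=
    hg.comp (M.measurable_partialSol s)
  have hgj' : ∀ n : (∀ i, 𝒩 i), Measurable fun p : 𝒩 i × (∀ i, Ω i) =>
      (M.nodeRegular ν i).indicator h (M.partialSol s (Function.update n i p.1) p.2) := fun n => by
    have hu : Measurable fun p : 𝒩 i × (∀ i, Ω i) => (Function.update n i p.1, p.2) := by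
      fun_prop
    exact hg.comp ((M.measurable_partialSol s).comp hu)
  have hdj : ∀ n, Measurable fun w =>
      h (M.partialSol (insert i s) n w) * M.nodeDensity ν i (M.partialSol (insert i s) n w) :=
    fun n => hd.comp ((M.measurable_partialSol (insert i s)).comp measurable_prodMk_left)
  rw [lintegral_hybridLaw _ _ _ hg, lintegral_hybridLaw _ _ _ hd]
  calc ∫⁻ n, ∫⁻ w, (M.nodeRegular ν i).indicator h (M.partialSol s n w) ∂(Measure.pi ν) ∂M.noise
    _ = ∫⁻ n, ∫⁻ m, ∫⁻ w, (M.nodeRegular ν i).indicator h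
          (M.partialSol s (Function.update n i m) w) ∂(Measure.pi ν) ∂(M.noiseLaw i) ∂M.noise := by
      have hm : Measurable fun n => ∫⁻ w, (M.nodeRegular ν i).indicator h (M.partialSol s n w)
          ∂(Measure.pi ν) := hgj.lintegral_prod_right'
      rw [M.noise_eq_pi hind]
      exact lintegral_pi_eq_lintegral_update M.noiseLaw i hm
    _ = ∫⁻ n, ∫⁻ w, ∫⁻ m, (M.nodeRegular ν i).indicator h
          (M.partialSol s (Function.update n i m) w) ∂(M.noiseLaw i) ∂(Measure.pi ν) ∂M.noise :=
      lintegral_congr fun n => lintegral_lintegral_swap (hgj' n).aemeasurable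
    _ = ∫⁻ n, ∫⁻ w, ∫⁻ x, h (M.partialSol (insert i s) n (Function.update w i x)) *
          M.nodeDensity ν i (M.partialSol (insert i s) n (Function.update w i x))
            ∂(ν i) ∂(Measure.pi ν) ∂M.noise :=
      lintegral_congr fun n => lintegral_congr fun w => M.lintegral_noiseLaw_update ν hi hh n w
    _ = _ := lintegral_congr fun n => (lintegral_pi_eq_lintegral_update ν i (hdj n)).symm

/-- The regular values of a node form a conull set for the product reference measure, because a node
is not its own parent. -/
theorem ae_mem_nodeRegular (i : ι) : ∀ᵐ x ∂Measure.pi ν, x ∈ M.nodeRegular ν i := by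
  classical
  have hms := (M.measurableSet_nodeRegular ν i).compl
  change Measure.pi ν (M.nodeRegular ν i)ᶜ = 0
  rw [← lintegral_indicator_one hms,
    lintegral_pi_eq_lintegral_update ν i (measurable_one.indicator hms)]
  refine lintegral_eq_zero_of_ae_eq_zero (Filter.Eventually.of_forall fun x => ?_)
  have hpre : Measurable (Function.update x i) := measurable_update x
  change ∫⁻ y, ((Function.update x i ⁻¹' (M.nodeRegular ν i)ᶜ).indicator 1 y) ∂ν i = 0
  rw [lintegral_indicator_one (hpre hms)]
  have hset : Function.update x i ⁻¹' (M.nodeRegular ν i)ᶜ =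
      Kernel.mutuallySingularSetSlice (M.nodeKernel i) (Kernel.const _ (ν i)) fun j => x j.1 := by
    ext y
    have hpar : (fun j : {j // M.edge j i} => Function.update x i y j.1) =
        fun j : {j // M.edge j i} => x j.1 := by
      funext j
      have hj : j.1 ≠ i := by
        have hno : ∀ k, M.edge k i → k ≠ i := by
          rintro k hk rfl
          exact M.acyclic k (.single hk)
        exact hno j.1 j.2
      exact Function.update_of_ne hj _ _
    simp only [nodeRegular, Set.mem_preimage, Set.mem_compl_iff, Set.mem_ofPred_eq, not_not, hpar,
      Function.update_self]
    rfl
  rw [hset]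
  exact Kernel.measure_mutuallySingularSetSlice (M.nodeKernel i) (Kernel.const _ (ν i)) _

theorem lintegral_hybridLaw_compl [DecidableEq ι] (hind : M.IndepNoise) (t : Finset ι)
    {h : (∀ i, Ω i) → ℝ≥0∞} (hh : Measurable h) :
    ∫⁻ x, (⋂ i ∈ t, M.nodeRegular ν i).indicator h x ∂(M.hybridLaw ν tᶜ) =
      ∫⁻ x, h x * ∏ i ∈ t, M.nodeDensity ν i x ∂(Measure.pi ν) := by
  induction t using Finset.induction_on generalizing h with
  | empty => simp [hybridLaw_univ]
  | insert i t hi ih =>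
    have hins : insert i (insert i t)ᶜ = tᶜ := by
      ext k
      by_cases hk : k = i
      · subst hk; simp [hi]
      · simp [hk]
    have hR : MeasurableSet (⋂ i ∈ t, M.nodeRegular ν i) :=
      t.measurableSet_biInter fun i _ => M.measurableSet_nodeRegular ν i
    have hset : (⋂ j ∈ insert i t, M.nodeRegular ν j) =
        M.nodeRegular ν i ∩ ⋂ j ∈ t, M.nodeRegular ν j := Finset.set_biInter_insert _ _ _
    simp_rw [hset, ← Set.indicator_indicator]
    rw [M.lintegral_hybridLaw_insert ν hind (by simp) (hh.indicator hR), hins]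
    simp_rw [Finset.prod_insert hi, ← mul_assoc]
    rw [← ih (h := fun x => h x * M.nodeDensity ν i x) (hh.mul (M.measurable_nodeDensity ν i))]
    refine lintegral_congr fun x => ?_
    simp only [Set.indicator]
    split_ifs <;> simp

/-- On the regular values, the law with the nodes outside `t` randomized has the product of the node
densities over `t` as its density. -/
theorem restrict_hybridLaw_compl [DecidableEq ι] (hind : M.IndepNoise) (t : Finset ι) :
    (M.hybridLaw ν tᶜ).restrict (⋂ i ∈ t, M.nodeRegular ν i) =
      (Measure.pi ν).withDensity fun x => ∏ i ∈ t, M.nodeDensity ν i x := by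
  have hR : MeasurableSet (⋂ i ∈ t, M.nodeRegular ν i) :=
    t.measurableSet_biInter fun i _ => M.measurableSet_nodeRegular ν i
  have hp : Measurable fun x => ∏ i ∈ t, M.nodeDensity ν i x :=
    Finset.measurable_fun_prod _ fun i _ => M.measurable_nodeDensity ν i
  refine Measure.ext_of_lintegral _ fun g hg => ?_
  rw [← lintegral_indicator hR, M.lintegral_hybridLaw_compl ν hind t hg,
    lintegral_withDensity_eq_lintegral_mul _ hp hg]
  exact lintegral_congr fun x => mul_comm _ _

theorem ae_mem_iInter_nodeRegular (t : Finset ι) :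
    ∀ᵐ x ∂Measure.pi ν, x ∈ ⋂ i ∈ t, M.nodeRegular ν i := by
  filter_upwards [ae_all_iff.2 fun i => M.ae_mem_nodeRegular ν i] with x hx
  simp [hx]

/-- An observational law with a density has the product of the node densities as its density. -/
theorem law_eq_withDensity (hind : M.IndepNoise) (hac : M.law ≪ Measure.pi ν) :
    M.law = (Measure.pi ν).withDensity fun x => ∏ i, M.nodeDensity ν i x := by
  classical
  rw [← M.restrict_hybridLaw_compl ν hind Finset.univ, Finset.compl_univ, hybridLaw_empty]
  exact (Measure.restrict_eq_self_of_ae_mem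
    (hac.ae_le (M.ae_mem_iInter_nodeRegular ν Finset.univ))).symm

/-- The regular values of the two models may differ, but those regular for both are conull, so equal
laws have equal densities. -/
theorem ae_prod_nodeDensity_eq [DecidableEq ι] {𝒩' : ι → Type*} [∀ i, MeasurableSpace (𝒩' i)]
    {M' : SCM Ω 𝒩'} (hind : M.IndepNoise) (hind' : M'.IndepNoise) (t : Finset ι)
    (h : M.hybridLaw ν tᶜ = M'.hybridLaw ν tᶜ) :
    ∀ᵐ x ∂Measure.pi ν, ∏ i ∈ t, M.nodeDensity ν i x = ∏ i ∈ t, M'.nodeDensity ν i x := by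
  set R := ⋂ i ∈ t, M.nodeRegular ν i
  set R' := ⋂ i ∈ t, M'.nodeRegular ν i
  have hR : MeasurableSet R := t.measurableSet_biInter fun i _ => M.measurableSet_nodeRegular ν i
  have hR' : MeasurableSet R' := t.measurableSet_biInter fun i _ => M'.measurableSet_nodeRegular ν i
  have hp : Measurable fun x => ∏ i ∈ t, M.nodeDensity ν i x :=
    Finset.measurable_fun_prod _ fun i _ => M.measurable_nodeDensity ν i
  have hp' : Measurable fun x => ∏ i ∈ t, M'.nodeDensity ν i x :=
    Finset.measurable_fun_prod _ fun i _ => M'.measurable_nodeDensity ν i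
  have hr := M.restrict_hybridLaw_compl ν hind t
  have hr' := M'.restrict_hybridLaw_compl ν hind' t
  have e : ((M.hybridLaw ν tᶜ).restrict R).restrict R' =
      (Measure.pi ν).withDensity fun x => ∏ i ∈ t, M.nodeDensity ν i x := by
    rw [hr]
    exact Measure.restrict_eq_self_of_ae_mem
      ((withDensity_absolutelyContinuous _ _).ae_le (M'.ae_mem_iInter_nodeRegular ν t))
  have e' : ((M'.hybridLaw ν tᶜ).restrict R').restrict R =
      (Measure.pi ν).withDensity fun x => ∏ i ∈ t, M'.nodeDensity ν i x := by
    rw [hr']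
    exact Measure.restrict_eq_self_of_ae_mem
      ((withDensity_absolutelyContinuous _ _).ae_le (M.ae_mem_iInter_nodeRegular ν t))
  have heq : (Measure.pi ν).withDensity (fun x => ∏ i ∈ t, M.nodeDensity ν i x) =
      (Measure.pi ν).withDensity fun x => ∏ i ∈ t, M'.nodeDensity ν i x := by
    rw [← e, ← e', h, Measure.restrict_restrict hR', Measure.restrict_restrict hR, Set.inter_comm]
  exact (withDensity_eq_iff_of_sigmaFinite hp.aemeasurable hp'.aemeasurable).1 heq

end Hybrid

/-- The product of all "leave one out" products is a power of the full product. -/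
theorem prod_prod_erase {ι R : Type*} [Fintype ι] [DecidableEq ι] [CommMonoid R] (a : ι → R) :
    ∏ i, ∏ j ∈ Finset.univ.erase i, a j = (∏ j, a j) ^ (Fintype.card ι - 1) := by
  rw [Finset.prod_comm' (t' := Finset.univ) (s' := fun j => Finset.univ.erase j)
    (fun i j => by simp [ne_comm]), ← Finset.prod_pow]
  refine Finset.prod_congr rfl fun j _ => ?_
  rw [Finset.prod_const, Finset.card_erase_of_mem (Finset.mem_univ j), Finset.card_univ]

/-- Two models with at least two nodes, with independent noises and observational densities, that
have the same single-node interventional laws have the same observational law. -/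
theorem law_eq_of_doInt_law_eq {ι : Type*} [Fintype ι] {Ω 𝒩₁ 𝒩₂ : ι → Type*}
    [∀ i, MeasurableSpace (Ω i)] [∀ i, StandardBorelSpace (Ω i)]
    [∀ i, MeasurableSpace (𝒩₁ i)] [∀ i, MeasurableSpace (𝒩₂ i)]
    (ν : ∀ i, Measure (Ω i)) [∀ i, IsProbabilityMeasure (ν i)]
    (M₁ : SCM Ω 𝒩₁) (M₂ : SCM Ω 𝒩₂) (hind₁ : M₁.IndepNoise) (hind₂ : M₂.IndepNoise)
    (hac₁ : M₁.law ≪ Measure.pi ν) (hac₂ : M₂.law ≪ Measure.pi ν)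
    (hcard : 2 ≤ Fintype.card ι)
    (h : ∀ i, ∀ᵐ y ∂(ν i), (M₁.doInt i y).law = (M₂.doInt i y).law) :
    M₁.law = M₂.law := by
  classical
  have hbind : ∀ i, M₁.hybridLaw ν (Finset.univ.erase i)ᶜ =
      M₂.hybridLaw ν (Finset.univ.erase i)ᶜ := fun i => by
    have hc : (Finset.univ.erase i)ᶜ = {i} := by ext; simp
    rw [hc, hybridLaw_singleton, hybridLaw_singleton]
    exact Measure.bind_congr_right (h i)
  rw [M₁.law_eq_withDensity ν hind₁ hac₁, M₂.law_eq_withDensity ν hind₂ hac₂]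
  refine withDensity_congr_ae ?_
  filter_upwards [ae_all_iff.2 fun i => M₁.ae_prod_nodeDensity_eq ν hind₁ hind₂ _ (hbind i)]
    with x hx
  have hpow : (∏ i, M₁.nodeDensity ν i x) ^ (Fintype.card ι - 1) =
      (∏ i, M₂.nodeDensity ν i x) ^ (Fintype.card ι - 1) := by
    rw [← prod_prod_erase, ← prod_prod_erase]
    exact Finset.prod_congr rfl fun i _ => hx i
  exact (ENNReal.pow_right_strictMono (by omega)).injective hpow

end SCM

/-! ### Interventional laws from counterfactual laws -/

namespace SCM

section Marginal

variable {ι : Type*} [Fintype ι] {Ω 𝒩 : ι → Type*}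
  [∀ i, MeasurableSpace (Ω i)] [∀ i, MeasurableSpace (𝒩 i)] (M : SCM Ω 𝒩)

/-- The observational law of node `j`. -/
noncomputable def marginal (j : ι) : Measure (Ω j) := M.noise.map fun n => M.sol n j

theorem measurable_sol_apply (j : ι) : Measurable fun n => M.sol n j :=
  (measurable_pi_apply j).comp M.measurable_sol

instance (j : ι) : IsProbabilityMeasure (M.marginal j) :=
  Measure.isProbabilityMeasure_map (M.measurable_sol_apply j).aemeasurable

theorem law_map_apply (j : ι) : M.law.map (fun x => x j) = M.marginal j :=
  Measure.map_map (measurable_pi_apply j) M.measurable_sol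

theorem marginal_absolutelyContinuous {ν : ∀ i, Measure (Ω i)} [∀ i, IsProbabilityMeasure (ν i)]
    (hac : M.law ≪ Measure.pi ν) (i : ι) : M.marginal i ≪ ν i := by
  rw [← M.law_map_apply, ← (measurePreserving_eval ν i).map_eq]
  exact hac.map (measurable_pi_apply i)

/-- The interventional laws of node `i`, as a Markov kernel in the intervened value. -/
noncomputable def doKernel (i : ι) : Kernel (Ω i) (∀ i, Ω i) where
  toFun y := (M.doInt i y).law
  measurable' := M.measurable_doInt_law i

instance (i : ι) : IsMarkovKernel (M.doKernel i) :=
  ⟨fun y => inferInstanceAs (IsProbabilityMeasure (M.doInt i y).law)⟩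

/-- Node `j` behaves like a source of the graph under single-node interventions with values drawn
from `μ`: almost every intervention on another node leaves its value almost surely unchanged. The
node may still have parents in the graph. -/
def EffectiveSource (μ : ∀ i, Measure (Ω i)) (j : ι) : Prop :=
  ∀ i ≠ j, ∀ᵐ y ∂(μ i), ∀ᵐ n ∂M.noise, (M.doInt i y).sol n j = M.sol n j

theorem effectiveSource_of_source {M : SCM Ω 𝒩} {μ : ∀ i, Measure (Ω i)} {j : ι}
    (hj : ∀ k, ¬ M.edge k j) : M.EffectiveSource μ j :=
  fun _ hi => .of_forall fun y => .of_forall fun n => M.doInt_sol_of_source hi hj y n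

theorem PairPositive.absolutelyContinuous_marginal [Nontrivial ι] {M : SCM Ω 𝒩}
    {ν : ∀ i, Measure (Ω i)} [∀ i, IsProbabilityMeasure (ν i)]
    (h : M.PairPositive ν) (j : ι) : ν j ≪ M.marginal j := by
  obtain ⟨i, hi⟩ := exists_ne j
  have h' := (h j i hi.symm).map (f := Prod.fst) measurable_fst
  rwa [measurePreserving_fst.map_eq, Measure.map_map measurable_fst (by fun_prop),
    show (Prod.fst ∘ fun x : ∀ i, Ω i => (x j, x i)) = fun x => x j from rfl,
    law_map_apply] at h'

end Marginal

section Counterfactual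

variable {ι : Type*} [Fintype ι] {Ω 𝒩 : ι → Type*}
  [∀ i, MeasurableSpace (Ω i)] [∀ i, MeasurableSpace (𝒩 i)]
  [∀ i, StandardBorelSpace (𝒩 i)] [∀ i, Nonempty (𝒩 i)] (M : SCM Ω 𝒩)

/-- The regular conditional law of the noise given the value of node `j`. -/
noncomputable def posterior (j : ι) : Kernel (Ω j) (∀ i, 𝒩 i) :=
  condDistrib id (fun n => M.sol n j) M.noise

instance (j : ι) : IsMarkovKernel (M.posterior j) := by
  unfold posterior
  infer_instance

theorem counterfactual_doInt_law (i j : ι) (x : Ω j) (y : Ω i) :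
    ((M.counterfactual j x).doInt i y).law = (M.posterior j x).map (M.doInt i y).sol := rfl

theorem marginal_compProd_posterior (j : ι) :
    M.marginal j ⊗ₘ M.posterior j = M.noise.map fun n => (M.sol n j, n) :=
  compProd_map_condDistrib (Y := id) aemeasurable_id

theorem ae_posterior_iff (j : ι) {p : Ω j → (∀ i, 𝒩 i) → Prop}
    (hp : MeasurableSet {q : Ω j × (∀ i, 𝒩 i) | p q.1 q.2}) :
    (∀ᵐ x ∂M.marginal j, ∀ᵐ n ∂M.posterior j x, p x n) ↔ ∀ᵐ n ∂M.noise, p (M.sol n j) n := by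
  rw [← Measure.ae_compProd_iff (p := fun q : Ω j × (∀ i, 𝒩 i) => p q.1 q.2) hp,
    marginal_compProd_posterior,
    ae_map_iff ((M.measurable_sol_apply j).prodMk measurable_id').aemeasurable hp]

theorem measurable_counterfactual_doInt_law (i j : ι) :
    Measurable fun p : Ω j × Ω i => ((M.counterfactual j p.1).doInt i p.2).law := by
  refine Measure.measurable_of_measurable_coe _ fun s hs => ?_
  have hF := M.measurable_doInt_sol i
  have hm : Measurable fun q : (Ω j × Ω i) × (∀ i, 𝒩 i) => (M.doInt i q.1.2).sol q.2 :=
    hF.comp ((measurable_snd.comp measurable_fst).prodMk measurable_snd)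
  set κ : Kernel (Ω j × Ω i) (∀ i, 𝒩 i) := (M.posterior j).comap Prod.fst measurable_fst
  have heq : ∀ p : Ω j × Ω i, ((M.counterfactual j p.1).doInt i p.2).law s =
      κ p (Prod.mk p ⁻¹'
        ((fun q : (Ω j × Ω i) × (∀ i, 𝒩 i) => (M.doInt i q.1.2).sol q.2) ⁻¹' s)) :=
    fun p => Measure.map_apply (M.doInt i p.2).measurable_sol hs
  simp_rw [heq]
  exact Kernel.measurable_kernel_prodMk_left (hm hs)

theorem map_sol_pair_eq_compProd (i j : ι) :
    M.noise.map (fun n => (M.sol n i, M.sol n j)) =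
      M.marginal i ⊗ₘ (M.posterior i).map fun n => M.sol n j := by
  rw [Measure.compProd_map (M.measurable_sol_apply j), marginal_compProd_posterior,
    Measure.map_map (by have := M.measurable_sol_apply j; fun_prop)
      ((M.measurable_sol_apply i).prodMk measurable_id')]
  rfl

/-- The interventional law is the mixture of the counterfactual interventional laws over the
observed value of any node. -/
theorem doInt_law_eq_bind (i j : ι) (y : Ω i) :
    (M.doInt i y).law =
      (M.marginal j).bind fun x => ((M.counterfactual j x).doInt i y).law := by
  have hm : Measurable fun x => ((M.counterfactual j x).doInt i y).law :=
    (M.measurable_counterfactual_doInt_law i j).comp measurable_prodMk_right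
  ext s hs
  have hs' : MeasurableSet ((M.doInt i y).sol ⁻¹' s) := (M.doInt i y).measurable_sol hs
  have h := congrArg (fun m => m (Set.univ ×ˢ ((M.doInt i y).sol ⁻¹' s)))
    (M.marginal_compProd_posterior j)
  beta_reduce at h
  rw [Measure.compProd_apply_prod .univ hs', Measure.map_apply
    ((M.measurable_sol_apply j).prodMk measurable_id') (MeasurableSet.univ.prod hs'),
    setLIntegral_univ] at h
  rw [Measure.bind_apply hs hm.aemeasurable, law,
    Measure.map_apply (M.doInt i y).measurable_sol hs]
  simp_rw [counterfactual_doInt_law, Measure.map_apply (M.doInt i y).measurable_sol hs]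
  rw [h]
  congr 1
  ext n
  simp [doInt]

end Counterfactual

section EffectiveSource

variable {ι : Type*} [Fintype ι] {Ω 𝒩 : ι → Type*}
  [∀ i, MeasurableSpace (Ω i)] [∀ i, StandardBorelSpace (Ω i)] [∀ i, MeasurableSpace (𝒩 i)]
  {M : SCM Ω 𝒩} {μ : ∀ i, Measure (Ω i)} [∀ i, IsProbabilityMeasure (μ i)] {j : ι}

/-- An effective source is a function of its own noise, because intervening on another node `i`
shows that it ignores the noise of `i`. Hence it is independent of the other noises. -/
theorem EffectiveSource.indepFun_update [DecidableEq ι] (hj : M.EffectiveSource μ j)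
    (hind : M.IndepNoise) (m : 𝒩 j) :
    IndepFun (fun n => M.sol n j) (fun n => Function.update n j m) M.noise := by
  obtain ⟨ψ, hψ, hae⟩ : ∃ ψ : 𝒩 j → Ω j, Measurable ψ ∧
      (fun n => M.sol n j) =ᵐ[M.noise] fun n => ψ (n j) := by
    rw [M.noise_eq_pi hind]
    refine exists_ae_eq_of_invariant M.noiseLaw (M.measurable_sol_apply j) j fun i hi => ?_
    obtain ⟨y, hy⟩ := (hj i hi).exists
    rw [M.noise_eq_pi hind] at hy
    refine ⟨fun n => (M.doInt i y).sol n j, (M.doInt i y).measurable_sol_apply j, ?_, ?_⟩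
    · filter_upwards [hy] with n hn using hn.symm
    · intro n m
      simp only [doInt_sol_update]
  have hfin := hind.indepFun_finset {j} (Finset.univ.erase j) (by simp)
    (fun i => measurable_pi_apply i)
  have hfactor : (fun n : ∀ i, 𝒩 i => Function.update n j m) =
      (fun z : (∀ k : (Finset.univ.erase j : Finset ι), 𝒩 k) => fun k =>
        if h : k = j then h.symm ▸ m else z ⟨k, by simp [h]⟩) ∘
      fun n (k : (Finset.univ.erase j : Finset ι)) => n k := by
    funext n k
    by_cases h : k = j
    · subst h; simp
    · simp [h]
  have hmeas : Measurable fun z : (∀ k : (Finset.univ.erase j : Finset ι), 𝒩 k) => fun k =>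
      if h : k = j then h.symm ▸ m else z ⟨k, by simp [h]⟩ := by
    refine measurable_pi_lambda _ fun k => ?_
    by_cases h : k = j
    · simp only [h, dite_true]
      exact measurable_const
    · simp only [h, dite_false]
      fun_prop
  rw [hfactor]
  have hleft : Measurable fun z : (∀ k : ({j} : Finset ι), 𝒩 k) =>
      ψ (z ⟨j, Finset.mem_singleton_self j⟩) := hψ.comp (measurable_pi_apply _)
  exact (hfin.comp hleft hmeas).congr hae.symm .rfl

variable [∀ i, Nonempty (𝒩 i)]

/-- For an effective source, conditioning on its value is the same as intervening on it. -/
theorem EffectiveSource.map_sol_eq_compProd (hj : M.EffectiveSource μ j) (hind : M.IndepNoise) :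
    M.noise.map (fun n => (M.sol n j, M.sol n)) = M.marginal j ⊗ₘ M.doKernel j := by
  classical
  obtain ⟨m⟩ : Nonempty (𝒩 j) := inferInstance
  have hum : Measurable fun n : ∀ i, 𝒩 i => Function.update n j m := measurable_update_left
  have hprod := (hj.indepFun_update hind m).map_prod_eq_prod_map_map
    (M.measurable_sol_apply j).aemeasurable hum.aemeasurable
  have hG : Measurable fun q : Ω j × (∀ i, 𝒩 i) => (q.1, (M.doInt j q.1).sol q.2) :=
    measurable_fst.prodMk (M.measurable_doInt_sol j)
  have hfun : (fun n => (M.sol n j, M.sol n)) =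
      (fun q : Ω j × (∀ i, 𝒩 i) => (q.1, (M.doInt j q.1).sol q.2)) ∘
        fun n => (M.sol n j, Function.update n j m) := by
    funext n
    simp only [Function.comp_apply, doInt_sol_update, doInt_sol_sol]
  ext s hs
  rw [hfun, ← Measure.map_map hG ((M.measurable_sol_apply j).prodMk hum), hprod,
    Measure.map_apply hG hs, Measure.prod_apply (hG hs), Measure.compProd_apply hs]
  refine lintegral_congr fun y => ?_
  rw [Measure.map_apply hum (measurable_prodMk_left (hG hs))]
  change _ = (M.noise.map (M.doInt j y).sol) _
  rw [Measure.map_apply (M.doInt j y).measurable_sol (measurable_prodMk_left hs)]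
  congr 1
  ext n
  simp only [Set.mem_preimage, doInt_sol_update]

theorem EffectiveSource.map_sol_pair_eq_compProd (hj : M.EffectiveSource μ j)
    (hind : M.IndepNoise) (i : ι) :
    M.noise.map (fun n => (M.sol n j, M.sol n i)) =
      M.marginal j ⊗ₘ (M.doKernel j).map fun z => z i := by
  rw [Measure.compProd_map (measurable_pi_apply i), ← hj.map_sol_eq_compProd hind,
    Measure.map_map (by fun_prop) ((M.measurable_sol_apply j).prodMk M.measurable_sol)]
  rfl

/-- For an effective source, the factual value carries no information on the outcome of an
intervention on it. -/
theorem EffectiveSource.counterfactual_doInt_law_ae [∀ i, StandardBorelSpace (𝒩 i)]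
    (hj : M.EffectiveSource μ j) (hind : M.IndepNoise) (y : Ω j) :
    ∀ᵐ x ∂M.marginal j, ((M.counterfactual j x).doInt j y).law = (M.doInt j y).law := by
  classical
  obtain ⟨m⟩ : Nonempty (𝒩 j) := inferInstance
  have hF := (M.doInt j y).measurable_sol
  have hXm := M.measurable_sol_apply j
  have hindep : IndepFun (fun n => M.sol n j) (M.doInt j y).sol M.noise := by
    have h := (hj.indepFun_update hind m).comp measurable_id hF
    have hfun : (M.doInt j y).sol ∘ (fun n => Function.update n j m) = (M.doInt j y).sol :=
      funext fun n => M.doInt_sol_update j y n m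
    rwa [hfun] at h
  have hne : Nonempty (∀ i, Ω i) := ⟨M.sol fun i => Classical.arbitrary _⟩
  have h₁ : condDistrib ((M.doInt j y).sol ∘ id) (fun n => M.sol n j) M.noise
      =ᵐ[M.marginal j] (M.posterior j).map (M.doInt j y).sol :=
    condDistrib_comp _ aemeasurable_id hF
  have h₂ : condDistrib ((M.doInt j y).sol ∘ id) (fun n => M.sol n j) M.noise
      =ᵐ[M.marginal j] Kernel.const _ (M.noise.map (M.doInt j y).sol) := by
    have : IsProbabilityMeasure (M.noise.map (M.doInt j y).sol) :=
      Measure.isProbabilityMeasure_map hF.aemeasurable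
    refine condDistrib_ae_eq_of_measure_eq_compProd _ (hF.comp measurable_id').aemeasurable ?_
    rw [Measure.compProd_const]
    exact hindep.map_prod_eq_prod_map_map hXm.aemeasurable hF.aemeasurable
  filter_upwards [h₁, h₂] with x hx₁ hx₂
  rw [counterfactual_doInt_law, ← Kernel.map_apply _ hF, ← hx₁, hx₂]
  rfl

/-- The counterfactual laws reveal whether an intervention on node `i` changes the value of node
`j`, although they do not contain the joint law of factual and intervened values: conditionally on
`X j = x` the factual value of `j` is the constant `x`. -/
theorem ae_counterfactual_doInt_apply_eq_iff [∀ i, StandardBorelSpace (𝒩 i)] (i j : ι) (y : Ω i) :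
    (∀ᵐ x ∂M.marginal j, ∀ᵐ z ∂((M.counterfactual j x).doInt i y).law, z j = x) ↔
      ∀ᵐ n ∂M.noise, (M.doInt i y).sol n j = M.sol n j := by
  have hF := (M.doInt i y).measurable_sol
  have hp : MeasurableSet {q : Ω j × (∀ i, 𝒩 i) | (M.doInt i y).sol q.2 j = q.1} :=
    measurableSet_eq_fun (((M.doInt i y).measurable_sol_apply j).comp measurable_snd) measurable_fst
  rw [← M.ae_posterior_iff j (p := fun x n => (M.doInt i y).sol n j = x) hp]
  refine Filter.eventually_congr (.of_forall fun x => ?_)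
  rw [counterfactual_doInt_law, ae_map_iff hF.aemeasurable]
  exact measurableSet_eq_fun (measurable_pi_apply j) measurable_const

end EffectiveSource

section TwoModels

variable {ι : Type*} [Fintype ι] {Ω 𝒩₁ 𝒩₂ : ι → Type*}
  [∀ i, MeasurableSpace (Ω i)] [∀ i, StandardBorelSpace (Ω i)]
  [∀ i, MeasurableSpace (𝒩₁ i)] [∀ i, StandardBorelSpace (𝒩₁ i)] [∀ i, Nonempty (𝒩₁ i)]
  [∀ i, MeasurableSpace (𝒩₂ i)] [∀ i, StandardBorelSpace (𝒩₂ i)] [∀ i, Nonempty (𝒩₂ i)]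
  {μ ν : ∀ i, Measure (Ω i)} {M₁ : SCM Ω 𝒩₁} {M₂ : SCM Ω 𝒩₂}

/-- Two models with equal counterfactual laws have the same effective sources. -/
theorem EffectiveSource.transfer {j : ι} (h₁ : M₁.EffectiveSource μ j)
    (hν₁ : ν j ≪ M₁.marginal j) (hν₂ : M₂.marginal j ≪ ν j)
    (hR : ∀ i, ∀ᵐ y ∂(μ i), ∀ᵐ x ∂(ν j),
      ((M₁.counterfactual j x).doInt i y).law = ((M₂.counterfactual j x).doInt i y).law) :
    M₂.EffectiveSource μ j := by
  intro i hi
  filter_upwards [h₁ i hi, hR i] with y hy hRy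
  rw [← ae_counterfactual_doInt_apply_eq_iff] at hy ⊢
  refine hν₂.ae_le ?_
  filter_upwards [hν₁.ae_le hy, hRy] with x hx hRx
  rwa [← hRx]

/-- If an intervention on node `i` leaves node `j` unchanged, then the conditional law of `j` given
`X i = x` is a marginal of the counterfactual law of that intervention given `X i = x`. -/
theorem map_posterior_ae_eq (M : SCM Ω 𝒩₁) {i j : ι} {y : Ω i}
    (h : ∀ᵐ n ∂M.noise, (M.doInt i y).sol n j = M.sol n j) :
    ∀ᵐ x ∂M.marginal i, (M.posterior i x).map (fun n => M.sol n j) =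
      ((M.counterfactual i x).doInt i y).law.map (fun z => z j) := by
  have hF := (M.doInt i y).measurable_sol
  have hp : MeasurableSet {q : Ω i × (∀ i, 𝒩₁ i) | (M.doInt i y).sol q.2 j = M.sol q.2 j} :=
    measurableSet_eq_fun (((M.doInt i y).measurable_sol_apply j).comp measurable_snd)
      ((M.measurable_sol_apply j).comp measurable_snd)
  have h' := (M.ae_posterior_iff i (p := fun _ n => (M.doInt i y).sol n j = M.sol n j) hp).2 h
  filter_upwards [h'] with x hx
  rw [counterfactual_doInt_law, Measure.map_map (measurable_pi_apply j) hF]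
  refine Measure.map_congr ?_
  filter_upwards [hx] with n hn using hn.symm

variable [∀ i, IsProbabilityMeasure (μ i)] [∀ i, IsProbabilityMeasure (ν i)]

/-- A common effective source has the same marginal law in both models: its joint law with any other
node has the same conditional laws in both directions. -/
theorem marginal_eq_of_effectiveSource {i j : ι} (hij : i ≠ j)
    (hj₁ : M₁.EffectiveSource μ j) (hj₂ : M₂.EffectiveSource μ j)
    (hind₁ : M₁.IndepNoise) (hind₂ : M₂.IndepNoise) (hμ : ν j ≪ μ j)
    (h₁j : M₁.marginal j ≪ ν j) (h₂j : M₂.marginal j ≪ ν j)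
    (h₁i : M₁.marginal i ≪ ν i) (h₂i : M₂.marginal i ≪ ν i)
    (hj₁' : ν j ≪ M₁.marginal j) (hj₂' : ν j ≪ M₂.marginal j)
    (hi₁' : ν i ≪ M₁.marginal i) (hi₂' : ν i ≪ M₂.marginal i)
    (hpos : M₂.PairPositive ν)
    (hRj : ∀ᵐ y ∂(μ j), ∀ᵐ x ∂(ν j),
      ((M₁.counterfactual j x).doInt j y).law = ((M₂.counterfactual j x).doInt j y).law)
    (hRi : ∀ᵐ y ∂(μ i), ∀ᵐ x ∂(ν i),
      ((M₁.counterfactual i x).doInt i y).law = ((M₂.counterfactual i x).doInt i y).law) :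
    M₁.marginal j = M₂.marginal j := by
  have hdo : ∀ᵐ y ∂(ν j), M₁.doKernel j y = M₂.doKernel j y := by
    refine hμ.ae_le ?_
    filter_upwards [hRj] with y hy
    have e₁ : ∀ᵐ x ∂(ν j), ((M₁.counterfactual j x).doInt j y).law = (M₁.doInt j y).law :=
      hj₁'.ae_le (hj₁.counterfactual_doInt_law_ae hind₁ y)
    have e₂ : ∀ᵐ x ∂(ν j), ((M₂.counterfactual j x).doInt j y).law = (M₂.doInt j y).law :=
      hj₂'.ae_le (hj₂.counterfactual_doInt_law_ae hind₂ y)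
    -- the counterfactual law does not depend on the observed value `x`, so any generic `x` will do
    obtain ⟨x, hx, hx₁, hx₂⟩ := (hy.and (e₁.and e₂)).exists
    exact hx₁.symm.trans (hx.trans hx₂)
  have hpost : ∀ᵐ x ∂(ν i), (M₁.posterior i x).map (fun n => M₁.sol n j) =
      (M₂.posterior i x).map (fun n => M₂.sol n j) := by
    obtain ⟨y, hy, hy₁, hy₂⟩ := (hRi.and ((hj₁ i hij).and (hj₂ i hij))).exists
    filter_upwards [hy, hi₁'.ae_le (map_posterior_ae_eq M₁ hy₁),
      hi₂'.ae_le (map_posterior_ae_eq M₂ hy₂)] with x hx hx₁ hx₂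
    rw [hx₁, hx₂, hx]
  have hm₁ := (M₁.measurable_sol_apply j).prodMk (M₁.measurable_sol_apply i)
  have hm₂ := (M₂.measurable_sol_apply j).prodMk (M₂.measurable_sol_apply i)
  set P := M₁.noise.map fun n => (M₁.sol n j, M₁.sol n i) with hP
  set Q := M₂.noise.map fun n => (M₂.sol n j, M₂.sol n i) with hQ
  have : IsProbabilityMeasure P := Measure.isProbabilityMeasure_map hm₁.aemeasurable
  have : IsProbabilityMeasure Q := Measure.isProbabilityMeasure_map hm₂.aemeasurable
  have hPf : P.fst = M₁.marginal j := Measure.map_map measurable_fst hm₁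
  have hPs : P.snd = M₁.marginal i := Measure.map_map measurable_snd hm₁
  have hQf : Q.fst = M₂.marginal j := Measure.map_map measurable_fst hm₂
  have hQs : Q.snd = M₂.marginal i := Measure.map_map measurable_snd hm₂
  have hPw : P.map Prod.swap = M₁.noise.map fun n => (M₁.sol n i, M₁.sol n j) :=
    Measure.map_map measurable_swap hm₁
  have hQw : Q.map Prod.swap = M₂.noise.map fun n => (M₂.sol n i, M₂.sol n j) :=
    Measure.map_map measurable_swap hm₂
  have : IsMarkovKernel ((M₁.doKernel j).map fun z => z i) :=
    Kernel.IsMarkovKernel.map _ (measurable_pi_apply i)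
  have : IsMarkovKernel ((M₂.doKernel j).map fun z => z i) :=
    Kernel.IsMarkovKernel.map _ (measurable_pi_apply i)
  have : IsMarkovKernel ((M₁.posterior i).map fun n => M₁.sol n j) :=
    Kernel.IsMarkovKernel.map _ (M₁.measurable_sol_apply j)
  have : IsMarkovKernel ((M₂.posterior i).map fun n => M₂.sol n j) :=
    Kernel.IsMarkovKernel.map _ (M₂.measurable_sol_apply j)
  rw [← hPf, ← hQf]
  refine fst_eq_of_conditionals_eq ((M₁.doKernel j).map fun z => z i)
    ((M₁.posterior i).map fun n => M₁.sol n j) ?_ ?_ ?_ ?_ ?_ ?_ ?_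
  · rw [hPf]
    exact hj₁.map_sol_pair_eq_compProd hind₁ i
  · rw [hQf, hQ, hj₂.map_sol_pair_eq_compProd hind₂ i]
    refine Measure.compProd_congr ?_
    filter_upwards [h₂j.ae_le hdo] with y hy
    rw [Kernel.map_apply _ (measurable_pi_apply i), Kernel.map_apply _ (measurable_pi_apply i), hy]
  · rw [hPw, hPs]
    exact map_sol_pair_eq_compProd M₁ i j
  · rw [hQw, hQs, map_sol_pair_eq_compProd M₂ i j]
    refine Measure.compProd_congr ?_
    filter_upwards [h₂i.ae_le hpost] with x hx
    rw [Kernel.map_apply _ (M₁.measurable_sol_apply j),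
      Kernel.map_apply _ (M₂.measurable_sol_apply j), hx]
  · rw [hPf, hQf]
    exact h₁j.trans hj₂'
  · rw [hPs, hQs]
    exact h₁i.trans hi₂'
  · rw [hQf, hQs]
    refine (h₂j.prod h₂i).trans ((hpos j i hij.symm).trans ?_)
    rw [law, Measure.map_map (by fun_prop) M₂.measurable_sol]
    exact .rfl

/-- Two models with independent noises and pairwise positive observational laws that have the same
counterfactual interventional laws have the same interventional laws. -/
theorem doInt_law_eq_of_counterfactual_eq (hμ : ∀ i, ν i ≪ μ i)
    (hind₁ : M₁.IndepNoise) (hind₂ : M₂.IndepNoise)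
    (hac₁ : ∀ i, M₁.marginal i ≪ ν i) (hac₂ : ∀ i, M₂.marginal i ≪ ν i)
    (hpos₁ : M₁.PairPositive ν) (hpos₂ : M₂.PairPositive ν)
    (hR : ∀ j i, ∀ᵐ y ∂(μ i), ∀ᵐ x ∂(ν j),
      ((M₁.counterfactual j x).doInt i y).law = ((M₂.counterfactual j x).doInt i y).law) (i : ι) :
    ∀ᵐ y ∂(μ i), (M₁.doInt i y).law = (M₂.doInt i y).law := by
  rcases subsingleton_or_nontrivial ι with hι | hι
  · -- a single node: both interventional laws are the point mass at the intervened value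
    refine .of_forall fun y => ?_
    obtain ⟨n₁⟩ : Nonempty (∀ i, 𝒩₁ i) := inferInstance
    have hval : ∀ z z' : ∀ i, Ω i, z i = y → z' i = y → z = z' := by
      intro z z' hz hz'
      funext k
      obtain rfl := Subsingleton.elim i k
      rw [hz, hz']
    have hc₁ : (M₁.doInt i y).sol = fun _ => (M₁.doInt i y).sol n₁ :=
      funext fun n => hval _ _ (M₁.doInt_sol_self i y n) (M₁.doInt_sol_self i y n₁)
    have hc₂ : (M₂.doInt i y).sol = fun _ => (M₁.doInt i y).sol n₁ :=
      funext fun n => hval _ _ (M₂.doInt_sol_self i y n) (M₁.doInt_sol_self i y n₁)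
    rw [law, law, hc₁, hc₂, Measure.map_const, Measure.map_const, measure_univ, measure_univ]
  · obtain ⟨j, hj⟩ := M₁.exists_source
    have hj₁ : M₁.EffectiveSource μ j := effectiveSource_of_source hj
    have hj₂ : M₂.EffectiveSource μ j :=
      hj₁.transfer (hpos₁.absolutelyContinuous_marginal j) (hac₂ j) (hR j)
    obtain ⟨k, hk⟩ := exists_ne j
    have hmarg : M₁.marginal j = M₂.marginal j :=
      marginal_eq_of_effectiveSource hk hj₁ hj₂ hind₁ hind₂ (hμ j) (hac₁ j) (hac₂ j) (hac₁ k)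
        (hac₂ k) (hpos₁.absolutelyContinuous_marginal j) (hpos₂.absolutelyContinuous_marginal j)
        (hpos₁.absolutelyContinuous_marginal k) (hpos₂.absolutelyContinuous_marginal k) hpos₂
        (hR j j) (hR k k)
    filter_upwards [hR j i] with y hy
    rw [M₁.doInt_law_eq_bind i j y, M₂.doInt_law_eq_bind i j y, ← hmarg]
    exact Measure.bind_congr_right ((hac₁ j).ae_le hy)

end TwoModels

end SCM

/-! ### Vanishing distances -/

namespace SCM

theorem average_eq_zero_iff {ι : Type*} [Fintype ι] (a : ι → ℝ≥0∞) :
    (Fintype.card ι : ℝ≥0∞)⁻¹ * ∑ i, a i = 0 ↔ ∀ i, a i = 0 := by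
  have h : (Fintype.card ι : ℝ≥0∞)⁻¹ ≠ 0 := ENNReal.inv_ne_zero.2 (ENNReal.natCast_ne_top _)
  rw [mul_eq_zero, or_iff_right h, Finset.sum_eq_zero_iff]
  simp

section Distances

variable {ι : Type*} [Fintype ι] {Ω 𝒩₁ 𝒩₂ : ι → Type*} [∀ i, MeasurableSpace (Ω i)]
  [∀ i, MeasurableSpace (𝒩₁ i)] [∀ i, MeasurableSpace (𝒩₂ i)]
  {D : Measure (∀ i, Ω i) → Measure (∀ i, Ω i) → ℝ≥0∞}

theorem ID_eq_zero_iff (hDmeas : Measurable (Function.uncurry D))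
    (hD : ∀ P Q : Measure (∀ i, Ω i), IsProbabilityMeasure P → IsProbabilityMeasure Q →
      (D P Q = 0 ↔ P = Q))
    (μ : ∀ i, Measure (Ω i)) (M₁ : SCM Ω 𝒩₁) (M₂ : SCM Ω 𝒩₂) :
    ID D μ M₁ M₂ = 0 ↔ ∀ i, ∀ᵐ y ∂(μ i), (M₁.doInt i y).law = (M₂.doInt i y).law := by
  rw [ID, average_eq_zero_iff]
  refine forall_congr' fun i => ?_
  have hm : Measurable fun y => D (M₁.doInt i y).law (M₂.doInt i y).law :=
    hDmeas.comp ((M₁.measurable_doInt_law i).prodMk (M₂.measurable_doInt_law i))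
  rw [lintegral_eq_zero_iff hm]
  exact Filter.eventually_congr (.of_forall fun y => hD _ _ inferInstance inferInstance)

/-- A vanishing counterfactual distance means that almost all counterfactual interventional laws
agree. The intervened value is quantified first, as it stays fixed in the mixture over the observed
values. -/
theorem ae_counterfactual_eq_of_CD_eq_zero
    [∀ i, StandardBorelSpace (𝒩₁ i)] [∀ i, Nonempty (𝒩₁ i)]
    [∀ i, StandardBorelSpace (𝒩₂ i)] [∀ i, Nonempty (𝒩₂ i)]
    (hDmeas : Measurable (Function.uncurry D))
    (hD : ∀ P Q : Measure (∀ i, Ω i), IsProbabilityMeasure P → IsProbabilityMeasure Q →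
      (D P Q = 0 ↔ P = Q))
    (μ ν : ∀ i, Measure (Ω i)) [∀ i, IsProbabilityMeasure (μ i)] [∀ i, IsProbabilityMeasure (ν i)]
    (M₁ : SCM Ω 𝒩₁) (M₂ : SCM Ω 𝒩₂) (h : CD D μ ν M₁ M₂ = 0) (j i : ι) :
    ∀ᵐ y ∂(μ i), ∀ᵐ x ∂(ν j),
      ((M₁.counterfactual j x).doInt i y).law = ((M₂.counterfactual j x).doInt i y).law := by
  have hjoint : ∀ i, Measurable fun p : Ω j × Ω i =>
      D ((M₁.counterfactual j p.1).doInt i p.2).law ((M₂.counterfactual j p.1).doInt i p.2).law :=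
    fun i => hDmeas.comp ((M₁.measurable_counterfactual_doInt_law i j).prodMk
      (M₂.measurable_counterfactual_doInt_law i j))
  have hm : Measurable fun x => ID D μ (M₁.counterfactual j x) (M₂.counterfactual j x) :=
    (Finset.measurable_fun_sum _ fun i _ => (hjoint i).lintegral_prod_right').const_mul _
  have hj := (average_eq_zero_iff _).1 h j
  rw [lintegral_eq_zero_iff hm] at hj
  have hae : ∀ᵐ x ∂(ν j), ∀ᵐ y ∂(μ i), D ((M₁.counterfactual j x).doInt i y).law
      ((M₂.counterfactual j x).doInt i y).law = 0 := by
    filter_upwards [hj] with x hx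
    filter_upwards [(ID_eq_zero_iff hDmeas hD μ _ _).1 hx i] with y hy
    exact (hD _ _ inferInstance inferInstance).2 hy
  have hms : MeasurableSet {p : Ω j × Ω i | D ((M₁.counterfactual j p.1).doInt i p.2).law
      ((M₂.counterfactual j p.1).doInt i p.2).law = 0} := hjoint i (measurableSet_singleton 0)
  filter_upwards [(Measure.ae_ae_comm hms).1 hae] with y hy
  filter_upwards [hy] with x hx using (hD _ _ inferInstance inferInstance).1 hx

end Distances

end SCM

theorem mainTheorem2 {ι : Type*} [Fintype ι] {Ω 𝒩₁ 𝒩₂ : ι → Type*}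
    [∀ i, MeasurableSpace (Ω i)] [∀ i, StandardBorelSpace (Ω i)]
    [∀ i, MeasurableSpace (𝒩₁ i)] [∀ i, StandardBorelSpace (𝒩₁ i)] [∀ i, Nonempty (𝒩₁ i)]
    [∀ i, MeasurableSpace (𝒩₂ i)] [∀ i, StandardBorelSpace (𝒩₂ i)] [∀ i, Nonempty (𝒩₂ i)]
    -- reference measures, and the distributions of the intervened and of the observed values
    (ref μ ν : ∀ i, Measure (Ω i)) [∀ i, SigmaFinite (ref i)]
    [∀ i, IsProbabilityMeasure (μ i)] [∀ i, IsProbabilityMeasure (ν i)]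
    (hμ : ∀ i, ref i ≪ μ i) (hν : ∀ i, ref i ≪ ν i) (hν' : ∀ i, ν i ≪ ref i)
    -- the distance between probability distributions
    (D : Measure (∀ i, Ω i) → Measure (∀ i, Ω i) → ℝ≥0∞)
    (hDmeas : Measurable (Function.uncurry D))
    (hD : ∀ P Q : Measure (∀ i, Ω i), IsProbabilityMeasure P → IsProbabilityMeasure Q →
      (D P Q = 0 ↔ P = Q))
    -- the two causal models
    (M₁ : SCM Ω 𝒩₁) (M₂ : SCM Ω 𝒩₂) (hind₁ : M₁.IndepNoise) (hind₂ : M₂.IndepNoise)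
    (hac₁ : M₁.law ≪ Measure.pi ref) (hac₂ : M₂.law ≪ Measure.pi ref) :
    (2 ≤ Fintype.card ι → SCM.ID D μ M₁ M₂ = 0 → SCM.OD D M₁ M₂ = 0) ∧
    (M₁.PairPositive ref → M₂.PairPositive ref →
      SCM.CD D μ ν M₁ M₂ = 0 → SCM.ID D μ M₁ M₂ = 0) := by
  -- the reference measures only matter through their null sets, so `ν` can take their place
  have hpi : Measure.pi ref ≪ Measure.pi ν := absolutelyContinuous_pi hν
  have hac₁' : M₁.law ≪ Measure.pi ν := hac₁.trans hpi
  have hac₂' : M₂.law ≪ Measure.pi ν := hac₂.trans hpi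
  have hνμ : ∀ i, ν i ≪ μ i := fun i => (hν' i).trans (hμ i)
  refine ⟨fun hcard hID => ?_, fun hpos₁ hpos₂ hCD => ?_⟩
  · rw [SCM.ID_eq_zero_iff hDmeas hD] at hID
    exact (hD _ _ inferInstance inferInstance).2 (SCM.law_eq_of_doInt_law_eq ν M₁ M₂ hind₁ hind₂
      hac₁' hac₂' hcard fun i => (hνμ i).ae_le (hID i))
  · rw [SCM.ID_eq_zero_iff hDmeas hD]
    exact SCM.doInt_law_eq_of_counterfactual_eq hνμ hind₁ hind₂
      (M₁.marginal_absolutelyContinuous hac₁') (M₂.marginal_absolutelyContinuous hac₂')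
      (fun i j hij => ((hν' i).prod (hν' j)).trans (hpos₁ i j hij))
      (fun i j hij => ((hν' i).prod (hν' j)).trans (hpos₂ i j hij))
      (SCM.ae_counterfactual_eq_of_CD_eq_zero hDmeas hD μ ν M₁ M₂ hCD)
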